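/- **Setting.** Let $\Gamma$ be a connected ribbon graph (orientable or not) of a finite abstract multigraph $G(V,E)$ with $V\ne\emptyset$ (loops and multiple edges allowed): a disc for each vertex and a flat or half-twisted band for each edge, attached to the discs in given cyclic orders. Let $\overline\Gamma$ be the closed surface obtained by attaching a disc (a face) to each boundary component. $\Gamma$ is plane if $\overline\Gamma$ is a sphere. An $n$-face coloring assigns one of $n$ colors to each face so that the faces on the two sides of every edge have different colors (so there is none if some edge has the same face on both sides). For $\alpha\in\{0,1\}^{E}$ let $|\alpha|=\sum_e\alpha_e$, and let the state graph $\Gamma_\alpha$ be the ribbon graph obtained from $\Gamma$ by inserting a half-twist into each band $e$ with $\alpha_e=1$. The blowup of $\Gamma$ replaces each vertex by a circle on which the edges at that vertex end. The state $\alpha$ is the set of immersed circles obtained from the blowup by replacing each $e\in E$ by two parallel strands if $\alpha_e=0$ and by two crossing strands if $\alpha_e=1$ (the other way round if the band of $e$ has a half-twist in $\Gamma$). Let $n\ge 1$, $m=\lfloor n/2\rfloor$, $\widehat V=\mathbb C[x]/(x^n-1)$, and let $\widehat V_\alpha$ be the tensor product of one copy of $\widehat V$ for each circle of the state $\alpha$.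 If $\alpha'$ arises from $\alpha$ by changing one entry $\alpha_e=0$ to $1$, then $\widehat\partial_{\alpha\alpha'}:\widehat V_\alpha\to\widehat V_{\alpha'}$ is the identity on the circles away from $e$, and on the others it is $x^i\otimes x^j\mapsto x^{i+j}$ if two circles are fused, $x^k\mapsto\sum_{0\le i,j<n,\ i+j\equiv k+2m\ (n)}x^i\otimes x^j$ if one circle is split, and $x^k\mapsto\sqrt n\,x^{k+m}$ if one circle becomes one circle. Order $E$. On $\widehat C^i=\bigoplus_{|\alpha|=i}\widehat V_\alpha$ let $\widehat\partial$ be the sum of the maps $\pm\widehat\partial_{\alpha\alpha'}$ with sign $(-1)^{\#\{e'<e\,:\,\alpha_{e'}=1\}}$. The filtered $n$-color homology $\widehat{CH}{}^i_n(\Gamma;\mathbb C)$ is the homology of $(\widehat C^*,\widehat\partial)$. With $\lambda=e^{2\pi\mathrm i/n}$, the colors $c_i=\frac1n\sum_{j=0}^{n-1}\lambda^{ij}x^j$, $0\le i<n$, form a basis of $\widehat V$; give each $\widehat V_\alpha$ the Hermitian metric for which the tensor products of colors are orthonormal. The space of harmonic colorings $\widehat{\mathcal{CH}}_n(\Gamma_\alpha)\subset\widehat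 V_\alpha$ consists of the elements annihilated by all $\widehat\partial_{\alpha\alpha'}$ with $|\alpha'|=|\alpha|+1$ and by all adjoints $\widehat\partial^*_{\gamma\alpha}$ with $|\gamma|=|\alpha|-1$. **Theorem.** The maps $\widehat\partial$ satisfy $\widehat\partial\circ\widehat\partial=0$, and: 1. For every $i$, $\widehat{CH}{}^i_n(\Gamma;\mathbb C)\cong\bigoplus_{|\alpha|=i}\widehat{\mathcal{CH}}_n(\Gamma_\alpha)$. If $\Gamma$ is plane, then $\widehat{\mathcal{CH}}_n(\Gamma_\alpha)$ can be nonzero only when $|\alpha|$ is even. 2. For every $\alpha$, $\dim\widehat{\mathcal{CH}}_n(\Gamma_\alpha)=\#\{n\text{-face colorings of }\overline\Gamma_\alpha\}$. 3. The state graph $\Gamma_{\vec 0}$ of the all-zero state is equivalent to $\Gamma$ as a ribbon graph (by a homeomorphism of the closed surfaces that induces an isomorphism of the graphs), and $\dim\widehat{CH}{}^0_n(\Gamma;\mathbb C)=\dim\widehat{\mathcal{CH}}_n(\Gamma_{\vec 0})=\#\{n\text{-face colorings of }\overline\Gamma\}$. In particular, if $\Gamma$ is plane, then $\dim\widehat{CH}{}^0_4(\Gamma;\mathbb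 C)$ is the number of $4$-face colorings of $\Gamma$. -/

import Mathlib

open scoped Polynomial TensorProduct DirectSum

/-! ### Ribbon graphs -/

/-- A ribbon graph with vertices `V` and edges `E`, given as a signed rotation system.  Each edge
`e` has the two half-edges `(e, false)` and `(e, true)`; `vert h` is the vertex at which `h` is
attached, and `rot h` is the next half-edge after `h` in the cyclic (counterclockwise) order
around the disc of that vertex.  The band of `e` is flat if `neg e = false` and carries a
half-twist if `neg e = true`.  Loops, multiple edges and vertices without edges are allowed. -/
structure RibbonGraph (V E : Type*) where
  vert : E × Bool → V
  rot : Equiv.Perm (E × Bool)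
  sameCycle_iff : ∀ h h', rot.SameCycle h h' ↔ vert h = vert h'
  neg : E → Bool

/-- The other half-edge of the same edge. -/
def oppHalf {E : Type*} (h : E × Bool) : E × Bool := (h.1, !h.2)

namespace RibbonGraph

variable {V E : Type*}

/-- The underlying abstract multigraph. -/
def graph (Γ : RibbonGraph V E) : Graph V E where
  vertexSet := Set.univ
  IsLink e x y := (Γ.vert (e, false) = x ∧ Γ.vert (e, true) = y) ∨
    (Γ.vert (e, false) = y ∧ Γ.vert (e, true) = x)
  isLink_symm := fun _ _ => ⟨fun _ _ h => h.symm⟩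
  eq_or_eq_of_isLink_of_isLink := by
    rintro e x y v w (⟨rfl, rfl⟩ | ⟨rfl, rfl⟩) (⟨rfl, rfl⟩ | ⟨rfl, rfl⟩) <;> simp
  left_mem_of_isLink := fun _ _ _ _ => Set.mem_univ _

/-- The underlying graph is connected (in particular, it has a vertex). -/
def Connected (Γ : RibbonGraph V E) : Prop :=
  Nonempty V ∧ ∀ u v : V, Relation.ReflTransGen Γ.graph.Adj u v

/-- Vertices without edges. -/
def Isolated (Γ : RibbonGraph V E) : Type _ := {v : V // ∀ h, Γ.vert h ≠ v}

instance [Finite V] (Γ : RibbonGraph V E) : Finite Γ.Isolated :=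
  inferInstanceAs (Finite {v : V // ∀ h, Γ.vert h ≠ v})

/-- Equivalence of ribbon graphs: an isomorphism `onVert`, `onHalf` of the underlying graphs that
is induced by a homeomorphism of the closed surfaces.  `flip v` records whether the disc of `v` is
turned over; turning it over reverses the rotation at `v` and changes the sign of each half-edge
at `v`. -/
structure Equivalence {V' E' : Type*} (Γ : RibbonGraph V E) (Γ' : RibbonGraph V' E') where
  onVert : V ≃ V'
  onHalf : E × Bool ≃ E' × Bool
  flip : V → Bool
  map_opp : ∀ h, onHalf (oppHalf h) = oppHalf (onHalf h)
  map_vert : ∀ h, Γ'.vert (onHalf h) = onVert (Γ.vert h)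
  map_rot : ∀ h, Γ'.rot (onHalf h) =
    onHalf (if flip (Γ.vert h) then Γ.rot.symm h else Γ.rot h)
  map_neg : ∀ h, Γ'.neg (onHalf h).1 =
    xor (Γ.neg h.1) (xor (flip (Γ.vert h)) (flip (Γ.vert (oppHalf h))))

/-! ### Faces of the closed associated surface -/

/-- Pieces of the boundary of the ribbon surface.  For a half-edge `h`, the points `(h, true)` and
`(h, false)` are the two corners at which the band of `h` meets the disc of its vertex, on the side
towards `rot h` and on the side towards `rot⁻¹ h`.  The disc of an isolated vertex contributes its
whole boundary circle. -/
def BoundaryPiece (Γ : RibbonGraph V E) : Type _ := ((E × Bool) × Bool) ⊕ Γ.Isolated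

instance [Finite V] [Finite E] (Γ : RibbonGraph V E) : Finite Γ.BoundaryPiece :=
  inferInstanceAs (Finite (((E × Bool) × Bool) ⊕ Γ.Isolated))

/-- Two corners are joined by a boundary segment of the ribbon surface: either a segment of the
boundary of a vertex disc between consecutive bands, or one of the two long sides of a band. -/
inductive BoundarySegment (Γ : RibbonGraph V E) : Γ.BoundaryPiece → Γ.BoundaryPiece → Prop
  | disc (h : E × Bool) : BoundarySegment Γ (Sum.inl (h, true)) (Sum.inl (Γ.rot h, false))
  | flatBand (h : E × Bool) (s : Bool) (hf : Γ.neg h.1 = false) :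
      BoundarySegment Γ (Sum.inl (h, s)) (Sum.inl (oppHalf h, !s))
  | twistedBand (h : E × Bool) (s : Bool) (ht : Γ.neg h.1 = true) :
      BoundarySegment Γ (Sum.inl (h, s)) (Sum.inl (oppHalf h, s))

/-- The faces of the closed associated surface: one disc is attached to each boundary component of
the ribbon surface. -/
def Face (Γ : RibbonGraph V E) : Type _ :=
  Quotient (Relation.EqvGen.setoid Γ.BoundarySegment)

instance [Finite V] [Finite E] (Γ : RibbonGraph V E) : Finite Γ.Face :=
  inferInstanceAs (Finite (Quotient (Relation.EqvGen.setoid Γ.BoundarySegment)))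

/-- The face that runs along the side `s` of the half-edge `h`. -/
def faceAt (Γ : RibbonGraph V E) (h : E × Bool) (s : Bool) : Γ.Face :=
  Quotient.mk (Relation.EqvGen.setoid Γ.BoundarySegment) (Sum.inl (h, s))

/-- An `n`-face coloring of the closed associated surface: the discs on the two sides of each edge
have different colors.  (If the same disc lies on both sides of some edge, there is none.) -/
def FaceColoring (Γ : RibbonGraph V E) (n : ℕ) : Type _ :=
  {f : Γ.Face → Fin n // ∀ e : E, f (Γ.faceAt (e, false) true) ≠ f (Γ.faceAt (e, false) false)}

/-- A connected ribbon graph is plane if its closed associated surface is a sphere, that is, has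
Euler characteristic `2`. -/
def IsPlane (Γ : RibbonGraph V E) : Prop :=
  (Nat.card V : ℤ) - Nat.card E + Nat.card Γ.Face = 2

/-- The state graph of `α`: a half-twist is inserted into the band of each edge `e` with
`α e = 1`; two half-twists in the same band cancel. -/
def stateGraph (Γ : RibbonGraph V E) (α : E → Bool) : RibbonGraph V E where
  vert := Γ.vert
  rot := Γ.rot
  sameCycle_iff := Γ.sameCycle_iff
  neg e := xor (Γ.neg e) (α e)

/-! ### States of the blowup -/

/-- The edges of the blowup outside its canonical perfect matching.  The blowup replaces each
vertex by a circle on which the half-edges at that vertex end; its trivalent vertices are the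
half-edges, its perfect matching edges are the original edges, and the remaining edges are the
arcs of the circles.  `Sum.inl h` is the arc from `h` to `rot h`; an isolated vertex becomes a
circle without vertices. -/
def Arc (Γ : RibbonGraph V E) : Type _ := (E × Bool) ⊕ Γ.Isolated

instance [Finite V] [Finite E] (Γ : RibbonGraph V E) : Finite Γ.Arc :=
  inferInstanceAs (Finite ((E × Bool) ⊕ Γ.Isolated))

/-- The arc that leaves the vertex `h` of the blowup in the direction of the rotation. -/
def arcAfter (Γ : RibbonGraph V E) (h : E × Bool) : Γ.Arc := Sum.inl h

/-- The arc that arrives at the vertex `h` of the blowup in the direction of the rotation. -/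
def arcBefore (Γ : RibbonGraph V E) (h : E × Bool) : Γ.Arc := Sum.inl (Γ.rot.symm h)

/-- The strands that replace the perfect matching edges in the state `α ∈ {0,1}^E`.  For a positive
edge the `0`-smoothing consists of two parallel strands and the `1`-smoothing of two crossing
strands; for a negative edge they are exchanged. -/
inductive Strand (Γ : RibbonGraph V E) (α : E → Bool) : Γ.Arc → Γ.Arc → Prop
  | parallel (h : E × Bool) (hp : α h.1 = Γ.neg h.1) :
      Strand Γ α (Γ.arcAfter h) (Γ.arcBefore (oppHalf h))
  | crossAfter (h : E × Bool) (hc : α h.1 ≠ Γ.neg h.1) :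
      Strand Γ α (Γ.arcAfter h) (Γ.arcAfter (oppHalf h))
  | crossBefore (h : E × Bool) (hc : α h.1 ≠ Γ.neg h.1) :
      Strand Γ α (Γ.arcBefore h) (Γ.arcBefore (oppHalf h))

/-- The (immersed) circles of the state `α`. -/
def Circle (Γ : RibbonGraph V E) (α : E → Bool) : Type _ :=
  Quotient (Relation.EqvGen.setoid (Γ.Strand α))

noncomputable instance [Finite V] [Finite E] (Γ : RibbonGraph V E) (α : E → Bool) :
    Fintype (Γ.Circle α) :=
  have : Finite (Γ.Circle α) :=
    inferInstanceAs (Finite (Quotient (Relation.EqvGen.setoid (Γ.Strand α))))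
  Fintype.ofFinite _

noncomputable instance (Γ : RibbonGraph V E) (α : E → Bool) : DecidableEq (Γ.Circle α) :=
  Classical.decEq _

/-- The circle of the state `α` through a given arc. -/
def circleOf (Γ : RibbonGraph V E) (α : E → Bool) (a : Γ.Arc) : Γ.Circle α :=
  Quotient.mk (Relation.EqvGen.setoid (Γ.Strand α)) a

/-- Some arc on a given circle. -/
noncomputable def someArc (Γ : RibbonGraph V E) {α : E → Bool} (c : Γ.Circle α) : Γ.Arc :=
  Quotient.out (s := Relation.EqvGen.setoid (Γ.Strand α)) c

end RibbonGraph

/-! ### The algebra `ℂ[x]/(xⁿ - 1)` and its color basis -/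

/-- The algebra `ℂ[x]/(xⁿ - 1)`. -/
abbrev ColorAlgebra (n : ℕ) : Type := AdjoinRoot (Polynomial.X ^ n - 1 : ℂ[X])

namespace ColorAlgebra

/-- The class of `x`. -/
noncomputable abbrev x (n : ℕ) : ColorAlgebra n := AdjoinRoot.root _

/-- `n / 2` for even `n` and `(n - 1) / 2` for odd `n`. -/
def shift (n : ℕ) : ℕ := n / 2

theorem monic (n : ℕ) [NeZero n] : (Polynomial.X ^ n - 1 : ℂ[X]).Monic := by
  simpa using Polynomial.monic_X_pow_sub_C (1 : ℂ) (NeZero.ne n)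

theorem dim_eq (n : ℕ) [NeZero n] : (AdjoinRoot.powerBasis' (monic n)).dim = n := by
  rw [AdjoinRoot.powerBasis'_dim]
  simpa using Polynomial.natDegree_X_pow_sub_C (n := n) (r := (1 : ℂ))

/-- The monomial basis `1, x, …, xⁿ⁻¹`. -/
noncomputable def monomialBasis (n : ℕ) [NeZero n] : Module.Basis (Fin n) ℂ (ColorAlgebra n) :=
  (AdjoinRoot.powerBasis' (monic n)).basis.reindex (finCongr (dim_eq n))

theorem monomialBasis_apply (n : ℕ) [NeZero n] (i : Fin n) :
    monomialBasis n i = x n ^ (i : ℕ) := by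
  rw [monomialBasis, Module.Basis.reindex_apply, PowerBasis.basis_eq_pow]
  rfl

/-- The primitive root of unity `λ = exp(2πi/n)`. -/
noncomputable def lam (n : ℕ) : ℂ := Complex.exp (2 * Real.pi * Complex.I / n)

/-- The color `cᵢ = (1/n) ∑ⱼ λ^{ij} xʲ`. -/
noncomputable def color (n : ℕ) (i : Fin n) : ColorAlgebra n :=
  (1 / n : ℂ) • ∑ j : Fin n, lam n ^ ((i : ℕ) * (j : ℕ)) • x n ^ (j : ℕ)

theorem x_pow (n : ℕ) : x n ^ n = 1 := by
  have h : AdjoinRoot.mk (Polynomial.X ^ n - 1 : ℂ[X]) (Polynomial.X ^ n - 1) = 0 :=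
    AdjoinRoot.mk_self
  rw [map_sub, map_pow, AdjoinRoot.mk_X, map_one, sub_eq_zero] at h
  exact h

theorem lam_pow (n : ℕ) [NeZero n] : lam n ^ n = 1 :=
  (Complex.isPrimitiveRoot_exp n (NeZero.ne n)).pow_eq_one

theorem lam_smul_x_mul_color (n : ℕ) [NeZero n] (i : Fin n) :
    (lam n ^ (i : ℕ) • x n) * color n i = color n i := by
  have h1 : color n i =
      (1 / n : ℂ) • ∑ j ∈ Finset.range n, (lam n ^ (i : ℕ) • x n) ^ j := by
    rw [color, Finset.sum_range]
    simp only [smul_pow, pow_mul]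
  have h2 : (lam n ^ (i : ℕ) • x n) ^ n = 1 := by
    rw [smul_pow, ← pow_mul, mul_comm, pow_mul, lam_pow, one_pow, x_pow, one_smul]
  have h3 := mul_geom_sum (lam n ^ (i : ℕ) • x n) n
  rw [h2, sub_self, sub_mul, one_mul, sub_eq_zero] at h3
  rw [h1, mul_smul_comm, h3]

theorem color_ne_zero (n : ℕ) [NeZero n] (i : Fin n) : color n i ≠ 0 := by
  intro h
  have hn : (n : ℂ) ≠ 0 := Nat.cast_ne_zero.mpr (NeZero.ne n)
  rw [color, smul_eq_zero, or_iff_right (one_div_ne_zero hn)] at h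
  simp only [← monomialBasis_apply] at h
  have := Fintype.linearIndependent_iff.mp (monomialBasis n).linearIndependent _ h 0
  simp at this

theorem linearIndependent_color (n : ℕ) [NeZero n] : LinearIndependent ℂ (color n) := by
  have hp := Complex.isPrimitiveRoot_exp n (NeZero.ne n)
  have h0 : lam n ≠ 0 := Complex.exp_ne_zero _
  refine Module.End.eigenvectors_linearIndependent' (LinearMap.mulLeft ℂ (x n))
    (fun i : Fin n => (lam n ^ (i : ℕ))⁻¹) ?_ _ ?_
  · intro i j hij
    exact Fin.ext (hp.pow_inj i.2 j.2 (inv_injective hij))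
  · intro i
    refine ⟨Module.End.mem_eigenspace_iff.mpr ?_, color_ne_zero n i⟩
    have h := lam_smul_x_mul_color n i
    rw [smul_mul_assoc] at h
    rw [LinearMap.mulLeft_apply, eq_inv_smul_iff₀ (pow_ne_zero _ h0), h]

/-- The color basis `c₀, …, cₙ₋₁`. -/
noncomputable def colorBasis (n : ℕ) [NeZero n] : Module.Basis (Fin n) ℂ (ColorAlgebra n) :=
  basisOfLinearIndependentOfCardEqFinrank (linearIndependent_color n)
    (Module.finrank_eq_card_basis (monomialBasis n)).symm

theorem colorBasis_apply (n : ℕ) [NeZero n] (i : Fin n) : colorBasis n i = color n i := by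
  simp [colorBasis]

end ColorAlgebra

/-! ### The filtered `n`-color complex -/

namespace RibbonGraph

open ColorAlgebra

variable {V E : Type*} [Finite V] [Fintype E] (Γ : RibbonGraph V E)
  (n : ℕ) [NeZero n]

/-- The vector space of a state: the tensor product of one copy of `ℂ[x]/(xⁿ - 1)` for each circle
of the state. -/
abbrev StateSpace (α : E → Bool) : Type _ := ⨂[ℂ] _c : Γ.Circle α, ColorAlgebra n

/-- The basis of tensor products of monomials. -/
noncomputable def monomialBasis (α : E → Bool) :
    Module.Basis (Γ.Circle α → Fin n) ℂ (Γ.StateSpace n α) :=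
  Basis.piTensorProduct fun _ => ColorAlgebra.monomialBasis n

/-- The basis of tensor products of colors; its elements are the colorings of the state. -/
noncomputable def colorBasis (α : E → Bool) :
    Module.Basis (Γ.Circle α → Fin n) ℂ (Γ.StateSpace n α) :=
  Basis.piTensorProduct fun _ => ColorAlgebra.colorBasis n

/-- The edge differential from the state `α` to the state `α'`, where `α'` arises from `α` by
replacing the `0`-smoothing at `e` by the `1`-smoothing.  It is given on tensor products of
monomials, `a c` being the exponent on the circle `c`.  In either state the two strands at `e` lie
on the circles through `arcAfter (e, false)` and `arcBefore (e, false)`; on all other circles,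
which the two states share, it is the identity.
* Two circles are fused: multiplication.
* One circle is split: `xᵏ ↦ ∑ xⁱ ⊗ xʲ` over all `0 ≤ i, j < n` with `i + j ≡ k + 2m` modulo `n`.
* One circle becomes one circle: `xᵏ ↦ √n xᵏ⁺ᵐ`. -/
noncomputable def edgeMap (α α' : E → Bool) (e : E) :
    Γ.StateSpace n α →ₗ[ℂ] Γ.StateSpace n α' :=
  (Γ.monomialBasis n α).constr ℂ fun a =>
    let c₁ := Γ.circleOf α (Γ.arcAfter (e, false))
    let c₂ := Γ.circleOf α (Γ.arcBefore (e, false))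
    let d₁ := Γ.circleOf α' (Γ.arcAfter (e, false))
    let d₂ := Γ.circleOf α' (Γ.arcBefore (e, false))
    let old : Γ.Circle α' → ℕ := fun d => a (Γ.circleOf α (Γ.someArc d))
    if c₁ ≠ c₂ then
      ⨂ₜ[ℂ] d, x n ^ (if d = d₁ then (a c₁ + a c₂ : ℕ) else old d)
    else if d₁ ≠ d₂ then
      ∑ p : Fin n × Fin n with (p.1 + p.2 : ℕ) ≡ a c₁ + 2 * shift n [MOD n],
        ⨂ₜ[ℂ] d, x n ^ (if d = d₁ then (p.1 : ℕ) else if d = d₂ then (p.2 : ℕ) else old d)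
    else
      (Real.sqrt n : ℂ) • ⨂ₜ[ℂ] d, x n ^ (if d = d₁ then a c₁ + shift n else old d)

/-- The Hermitian metric on the space of a state for which the colorings are orthonormal. -/
noncomputable def metric (α : E → Bool) (u v : Γ.StateSpace n α) : ℂ :=
  ∑ I, (Γ.colorBasis n α).repr u I * (starRingEnd ℂ) ((Γ.colorBasis n α).repr v I)

/-- The adjoint of a linear map between the spaces of two states, with respect to the metrics for
which the colorings are orthonormal. -/
noncomputable def adjoint {α α' : E → Bool} (f : Γ.StateSpace n α →ₗ[ℂ] Γ.StateSpace n α') :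
    Γ.StateSpace n α' →ₗ[ℂ] Γ.StateSpace n α :=
  Matrix.toLin (Γ.colorBasis n α') (Γ.colorBasis n α)
    (LinearMap.toMatrix (Γ.colorBasis n α) (Γ.colorBasis n α') f).conjTranspose

theorem metric_adjoint {α α' : E → Bool} (f : Γ.StateSpace n α →ₗ[ℂ] Γ.StateSpace n α')
    (u : Γ.StateSpace n α) (v : Γ.StateSpace n α') :
    Γ.metric n α' (f u) v = Γ.metric n α u (Γ.adjoint n f v) := by
  have h1 : ∀ I, (Γ.colorBasis n α').repr (f u) I =
      ((LinearMap.toMatrix (Γ.colorBasis n α) (Γ.colorBasis n α') f).mulVec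
        ((Γ.colorBasis n α).repr u)) I := fun I => by
    rw [LinearMap.toMatrix_mulVec_repr]
  have h2 : ∀ I, (Γ.colorBasis n α).repr (Γ.adjoint n f v) I =
      ((LinearMap.toMatrix (Γ.colorBasis n α) (Γ.colorBasis n α') f).conjTranspose.mulVec
        ((Γ.colorBasis n α').repr v)) I := fun I => by
    rw [← LinearMap.toMatrix_mulVec_repr (Γ.colorBasis n α') (Γ.colorBasis n α), adjoint,
      LinearMap.toMatrix_toLin]
  simp only [metric, h1, h2, Matrix.mulVec, dotProduct, map_sum, map_mul, Finset.sum_mul,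
    Finset.mul_sum, Matrix.conjTranspose_apply, starRingEnd_apply, star_star]
  rw [Finset.sum_comm]
  refine Finset.sum_congr rfl fun I _ => Finset.sum_congr rfl fun J _ => ?_
  ring

/-- `|α|`, the number of `1`-smoothings. -/
def weight (α : E → Bool) : ℕ := (Finset.univ.filter fun e => α e = true).card

variable [LinearOrder E]

theorem weight_update_false {i : ℕ} {β : E → Bool} (hβ : weight β = i + 1) {e : E}
    (he : β e = true) : weight (Function.update β e false) = i := by
  have h : (Finset.univ.filter fun e' => Function.update β e false e' = true) =
      (Finset.univ.filter fun e' => β e' = true).erase e := by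
    ext e'
    by_cases h : e' = e <;> simp [h, Function.update_apply]
  rw [weight, h, Finset.card_erase_of_mem (by simp [he])]
  rw [weight] at hβ
  omega

/-- The chain group in degree `i`, the direct sum of the spaces of the states with `|α| = i`. -/
abbrev Chain (i : ℕ) : Type _ := ∀ α : {α : E → Bool // weight α = i}, Γ.StateSpace n α.1

/-- The differential, the signed sum of the edge differentials; the sign is given by the number of
`1`s before the changed entry in the chosen order of the edges. -/
noncomputable def differential (i : ℕ) : Γ.Chain n i →ₗ[ℂ] Γ.Chain n (i + 1) :=
  LinearMap.pi fun β => ∑ e : {e : E // β.1 e = true},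
    ((-1 : ℂ) ^ (Finset.univ.filter fun e' => e' < e.1 ∧ β.1 e' = true).card) •
      (Γ.edgeMap n (Function.update β.1 e.1 false) β.1 e.1 ∘ₗ
        LinearMap.proj (⟨Function.update β.1 e.1 false, weight_update_false β.2 e.2⟩ :
          {α : E → Bool // weight α = i}))

/-- The image of the differential into degree `i`; there is nothing below degree `0`. -/
noncomputable def boundaries : (i : ℕ) → Submodule ℂ (Γ.Chain n i)
  | 0 => ⊥
  | i + 1 => LinearMap.range (Γ.differential n i)

/-- The filtered `n`-color homology over `ℂ` in degree `i`. -/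
abbrev FilteredHomology (i : ℕ) : Type _ :=
  LinearMap.ker (Γ.differential n i) ⧸
    (Γ.boundaries n i).comap (LinearMap.ker (Γ.differential n i)).subtype

/-! ### Harmonic colorings of a state -/

/-- The sum of all edge differentials out of the space of the state `α`, with values in the direct
sum of the spaces of the states that follow `α` in the hypercube. -/
noncomputable def outgoing (α : E → Bool) : Γ.StateSpace n α →ₗ[ℂ]
    ∀ e : {e : E // α e = false}, Γ.StateSpace n (Function.update α e.1 true) :=
  LinearMap.pi fun e => Γ.edgeMap n α (Function.update α e.1 true) e.1

/-- The sum of the adjoints of all edge differentials into the space of the state `α`, with values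
in the direct sum of the spaces of the states that precede `α` in the hypercube. -/
noncomputable def incomingAdjoint (α : E → Bool) : Γ.StateSpace n α →ₗ[ℂ]
    ∀ e : {e : E // α e = true}, Γ.StateSpace n (Function.update α e.1 false) :=
  LinearMap.pi fun e => Γ.adjoint n (Γ.edgeMap n (Function.update α e.1 false) α e.1)

/-- The space of harmonic colorings of the state `α`. -/
noncomputable def harmonic (α : E → Bool) : Submodule ℂ (Γ.StateSpace n α) :=
  LinearMap.ker (Γ.outgoing n α) ⊓ LinearMap.ker (Γ.incomingAdjoint n α)

end RibbonGraph

/-! The proof diagonalizes the complex in the color basis. The element `x` acts on each color by a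
scalar `char`, so fusing keeps equal colors and kills unequal ones, splitting sends a color `c` to a
multiple of `c ⊗ c`, and a circle that stays one circle has its color multiplied by the scalar
`twist`. The splitting multiple is the square of `twist`. Hence all three scalars are quotients of
one function `gauge` of the state and the coloring (`coordinate_edgeMap`), and after dividing
coordinates by `gauge` every edge map has coefficients `0` and `1`.

Colorings of different states are compared as functions `f` on the arcs of the blowup, a set
independent of the state. The complex then splits over `f`. If `f` is compatible with some state,
the states compatible with it form a face of the cube: an entry is free at a monochromatic edge
(`Compatible.of_mono`) and fixed at any other edge (`Compatible.mono`). With a free direction the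
summand is contractible (`cubeDiff_cubeContract`); without one it is a single copy of the scalars in
degree `|α|`. The colorings of `α` without monochromatic edges therefore give the homology. They
also span the harmonic space (`mem_harmonic_iff`), because a color vector is seen by an edge map or
its adjoint exactly when it is monochromatic at that edge. As the boundary of the ribbon surface of
`Γ_α` runs along the circles of `α`, these colorings are the face colorings of `Γ_α`.

Evenness in the plane case (`even_weight_of_isPlane`) is the fact that closed curves of different
colors cross an even number of times. For each color, its strands form a cycle modulo `2`, which
bounds because the surface is a sphere (`exists_faceFunction`); summing the bounding functions over
smaller colors along each strand counts the crossings. -/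

namespace RibbonGraph

/-! ### Arc colorings compatible with a state -/

section States

variable {V E X : Type*} (Γ : RibbonGraph V E)

/-- The arc of the blowup that ends at the side `s` of the half-edge `h`. -/
def cornerArc (h : E × Bool) : Bool → Γ.Arc
  | true => Γ.arcAfter h
  | false => Γ.arcBefore h

/-- A function on the arcs that is constant along the strands of the state `α`. -/
def Compatible (α : E → Bool) (f : Γ.Arc → X) : Prop :=
  ∀ x y, Γ.Strand α x y → f x = f y

/-- The four arcs that end at the edge `e` have only one color. -/
def Mono (f : Γ.Arc → X) (e : E) : Prop :=
  f (Γ.arcAfter (e, false)) = f (Γ.arcBefore (e, false))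

variable {Γ}

/-- Parallel strands exchange the two sides of a half-edge and crossing strands preserve them, so a
single formula in `xor` covers both smoothings. Flat and twisted bands obey the same rule, which
later identifies circles with faces. -/
theorem compatible_iff {α : E → Bool} {f : Γ.Arc → X} :
    Γ.Compatible α f ↔ ∀ h s, f (Γ.cornerArc h s) =
      f (Γ.cornerArc (oppHalf h) (xor s (!(xor (α h.1) (Γ.neg h.1))))) := by
  constructor
  · intro hf h s
    by_cases hp : α h.1 = Γ.neg h.1
    · have h1 := hf _ _ (Strand.parallel h hp)
      have h2 := hf _ _ (Strand.parallel (oppHalf h) hp)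
      have h3 : oppHalf (oppHalf h) = h := by simp [oppHalf]
      rw [h3] at h2
      cases s <;> simp [hp, cornerArc, h1, h2]
    · have h1 := hf _ _ (Strand.crossAfter h hp)
      have h2 := hf _ _ (Strand.crossBefore h hp)
      have h3 : (xor (α h.1) (Γ.neg h.1)) = true := by simpa using hp
      cases s <;> simp [h3, cornerArc, h1, h2]
  · rintro hf x y (⟨h, hp⟩ | ⟨h, hc⟩ | ⟨h, hc⟩)
    · simpa [hp, cornerArc] using hf h true
    · have h3 : (xor (α h.1) (Γ.neg h.1)) = true := by simpa using hc
      simpa [h3, cornerArc] using hf h true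
    · have h3 : (xor (α h.1) (Γ.neg h.1)) = true := by simpa using hc
      simpa [h3, cornerArc] using hf h false

theorem compatible_circleOf (α : E → Bool) : Γ.Compatible α (Γ.circleOf α) :=
  fun x y h => Quotient.sound (s := Relation.EqvGen.setoid (Γ.Strand α)) (.rel x y h)

/-- The function on the circles of a state induced by a compatible function on the arcs. -/
def Compatible.lift {α : E → Bool} {f : Γ.Arc → X} (hf : Γ.Compatible α f) (c : Γ.Circle α) : X :=
  Quotient.lift (s := Relation.EqvGen.setoid (Γ.Strand α)) f (fun x y h => by
    induction h with
    | rel x y h => exact hf x y h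
    | refl => rfl
    | symm _ _ _ ih => exact ih.symm
    | trans _ _ _ _ _ ih₁ ih₂ => exact ih₁.trans ih₂) c

@[simp]
theorem Compatible.lift_circleOf {α : E → Bool} {f : Γ.Arc → X} (hf : Γ.Compatible α f)
    (x : Γ.Arc) : hf.lift (Γ.circleOf α x) = f x := rfl

@[simp]
theorem circleOf_someArc {α : E → Bool} (c : Γ.Circle α) : Γ.circleOf α (Γ.someArc c) = c :=
  Quotient.out_eq (s := Relation.EqvGen.setoid (Γ.Strand α)) c

theorem Compatible.apply_someArc {α : E → Bool} {f : Γ.Arc → X} (hf : Γ.Compatible α f)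
    (c : Γ.Circle α) : f (Γ.someArc c) = hf.lift c := by
  rw [← hf.lift_circleOf, circleOf_someArc]

theorem Compatible.eq_of_circleOf_eq {α : E → Bool} {f : Γ.Arc → X} (hf : Γ.Compatible α f)
    {x y : Γ.Arc} (h : Γ.circleOf α x = Γ.circleOf α y) : f x = f y := by
  rw [← hf.lift_circleOf, h, hf.lift_circleOf]

theorem Compatible.comp {Y : Type*} {α : E → Bool} {f : Γ.Arc → X} (hf : Γ.Compatible α f)
    (g : X → Y) : Γ.Compatible α (g ∘ f) := fun x y h => congrArg g (hf x y h)

variable (Γ) in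
/-- Colorings of the circles of a state are the compatible colorings of the arcs. -/
def compatibleEquiv (α : E → Bool) : (Γ.Circle α → X) ≃ {f : Γ.Arc → X // Γ.Compatible α f} where
  toFun I := ⟨I ∘ Γ.circleOf α, (compatible_circleOf α).comp I⟩
  invFun f := f.2.lift
  left_inv I := by
    funext c
    rw [← circleOf_someArc c]
    rfl
  right_inv f := rfl

theorem Compatible.apply_eq_of_mono {α : E → Bool} {f : Γ.Arc → X} (hf : Γ.Compatible α f) {e : E}
    (he : Γ.Mono f e) (b s : Bool) :
    f (Γ.cornerArc (e, b) s) = f (Γ.arcAfter (e, false)) := by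
  have h1 : ∀ s, f (Γ.cornerArc (e, false) s) = f (Γ.arcAfter (e, false)) := by
    rintro (_ | _)
    · exact he.symm
    · rfl
  cases b
  · exact h1 s
  · exact (compatible_iff.mp hf (e, true) s).trans (h1 _)

/-- Compatibility with a second state that agrees with the first at all edges that are not
monochromatic. -/
theorem Compatible.of_mono {α β : E → Bool} {f : Γ.Arc → X} (hf : Γ.Compatible α f)
    (h : ∀ e, α e ≠ β e → Γ.Mono f e) : Γ.Compatible β f := by
  rw [compatible_iff]
  rintro ⟨e, b⟩ s
  by_cases he : α e = β e
  · simpa [he] using compatible_iff.mp hf (e, b) s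
  · rw [hf.apply_eq_of_mono (h e he), oppHalf, hf.apply_eq_of_mono (h e he)]

/-- The parallel and the crossing strands at `e` together connect all four arc ends there. -/
theorem Compatible.mono {α β : E → Bool} {f : Γ.Arc → X} (hα : Γ.Compatible α f)
    (hβ : Γ.Compatible β f) {e : E} (h : α e ≠ β e) : Γ.Mono f e := by
  have key : ∀ {α β : E → Bool}, Γ.Compatible α f → Γ.Compatible β f → α e = Γ.neg e →
      β e ≠ Γ.neg e → Γ.Mono f e := by
    intro α β hα hβ h1 h2
    have h3 := hα _ _ (Strand.parallel (e, true) h1)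
    exact (hβ _ _ (Strand.crossAfter (e, false) h2)).trans h3
  by_cases h1 : α e = Γ.neg e
  · exact key hα hβ h1 (h1 ▸ h.symm)
  · refine key hβ hα ?_ h1
    revert h h1
    cases α e <;> cases β e <;> cases Γ.neg e <;> simp

/-- A function that is compatible with the state away from `e` and constant at `e`. -/
theorem compatible_of_const {α β : E → Bool} {f : Γ.Arc → X} {e : E} {a : X}
    (h : ∀ e', e' ≠ e → α e' = β e') (hα : ∀ g s, g.1 ≠ e → f (Γ.cornerArc g s) =
      f (Γ.cornerArc (oppHalf g) (xor s (!(xor (α g.1) (Γ.neg g.1))))))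
    (he : ∀ b s, f (Γ.cornerArc (e, b) s) = a) : Γ.Compatible β f := by
  rw [compatible_iff]
  rintro ⟨e', b⟩ s
  by_cases hee : e' = e
  · subst hee
    rw [he, oppHalf, he]
  · simpa [h e' hee] using hα (e', b) s hee

/-- Each arc on the circle of a vertex has two ends, both at that vertex, so it is counted twice.
This handshake argument drives every parity statement below. -/
theorem sum_arcBefore_add_arcAfter [Fintype E] [DecidableEq V] (v : V) (u : Γ.Arc → ZMod 2) :
    ∑ h : E × Bool, (if Γ.vert h = v then
      u (Γ.arcAfter h) + u (Γ.arcBefore h) else 0) = 0 := by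
  have h1 : ∀ h, Γ.vert (Γ.rot h) = Γ.vert h := fun h =>
    ((Γ.sameCycle_iff _ _).mp (Equiv.Perm.sameCycle_apply_right.mpr (.refl _ _))).symm
  have h2 : ∑ h : E × Bool, (if Γ.vert h = v then u (Γ.arcBefore h) else 0) =
      ∑ h : E × Bool, (if Γ.vert h = v then u (Γ.arcAfter h) else 0) := by
    rw [← Equiv.sum_comp Γ.rot]
    simp [h1, arcBefore, arcAfter]
  simp_rw [ite_add_zero, Finset.sum_add_distrib, h2]
  exact CharTwo.add_self_eq_zero _

theorem sum_cornerArc [Fintype E] (u : Γ.Arc → ZMod 2) :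
    ∑ h : E × Bool, (u (Γ.arcAfter h) + u (Γ.arcBefore h)) = 0 := by
  have h2 : ∑ h : E × Bool, u (Γ.arcBefore h) = ∑ h : E × Bool, u (Γ.arcAfter h) := by
    rw [← Equiv.sum_comp Γ.rot]
    simp [arcBefore, arcAfter]
  rw [Finset.sum_add_distrib, h2]
  exact CharTwo.add_self_eq_zero _

end States

/-! ### Changing the smoothing of one edge -/

section Neighbors

variable {V E X : Type*} {Γ : RibbonGraph V E} {α β : E → Bool} {e : E}

/-- If the smoothing at `e` is changed and the two strands at `e` lie on different circles
before, then they lie on the same circle afterwards. -/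
theorem circleOf_eq_of_circleOf_ne [Fintype E] (h : ∀ e', e' ≠ e → α e' = β e') (he : α e ≠ β e)
    (hα : Γ.circleOf α (Γ.arcAfter (e, false)) ≠ Γ.circleOf α (Γ.arcBefore (e, false))) :
    Γ.circleOf β (Γ.arcAfter (e, false)) = Γ.circleOf β (Γ.arcBefore (e, false)) := by
  classical
  by_contra hβ
  -- Suppose the strands at `e` lie on different circles in both states, and mark the arcs that
  -- share both circles with `arcAfter (e, false)`. Marked arc ends total an even number and pair up
  -- at every edge other than `e`; at `e` exactly one of the four ends is marked.
  let u : Γ.Arc → ZMod 2 := fun x =>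
    if Γ.circleOf α x = Γ.circleOf α (Γ.arcAfter (e, false)) ∧
      Γ.circleOf β x = Γ.circleOf β (Γ.arcAfter (e, false)) then 1 else 0
  have hsum := sum_cornerArc u
  have hother : ∀ e', e' ≠ e → u (Γ.arcAfter (e', false)) + u (Γ.arcBefore (e', false)) +
      (u (Γ.arcAfter (e', true)) + u (Γ.arcBefore (e', true))) = 0 := by
    intro e' hee
    have h1 : ∀ s, u (Γ.cornerArc (e', false) s) =
        u (Γ.cornerArc (e', true) (xor s (!(xor (α e') (Γ.neg e'))))) := by
      intro s
      have h2 := compatible_iff.mp (compatible_circleOf (Γ := Γ) α) (e', false) s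
      have h3 := compatible_iff.mp (compatible_circleOf (Γ := Γ) β) (e', false) s
      simp only [← h e' hee] at h3
      simp only [u, h2, h3]
      rfl
    have ht := h1 true
    have hf := h1 false
    simp only [cornerArc] at ht hf
    rw [ht, hf]
    cases hx : xor (α e') (Γ.neg e') <;> simp only [Bool.xor_false, Bool.xor_true,
      Bool.not_false, Bool.not_true] <;> ring_nf <;> simp [show (2 : ZMod 2) = 0 from rfl]
  have hthis : u (Γ.arcAfter (e, false)) + u (Γ.arcBefore (e, false)) +
      (u (Γ.arcAfter (e, true)) + u (Γ.arcBefore (e, true))) = 1 := by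
    have key : ∀ {α β : E → Bool}, α e = Γ.neg e → β e ≠ Γ.neg e →
        Γ.circleOf α (Γ.arcAfter (e, true)) = Γ.circleOf α (Γ.arcBefore (e, false)) ∧
        Γ.circleOf β (Γ.arcBefore (e, true)) = Γ.circleOf β (Γ.arcBefore (e, false)) :=
      fun h1 h2 => ⟨compatible_circleOf _ _ _ (Strand.parallel (e, true) h1),
        compatible_circleOf _ _ _ (Strand.crossBefore (e, true) h2)⟩
    by_cases h1 : α e = Γ.neg e
    · obtain ⟨h3, h4⟩ := key h1 (h1 ▸ he.symm)
      simp [u, h3, h4, Ne.symm hα, Ne.symm hβ]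
    · have h2 : β e = Γ.neg e := by
        revert he h1
        cases α e <;> cases β e <;> cases Γ.neg e <;> simp
      obtain ⟨h3, h4⟩ := key h2 h1
      simp [u, h3, h4, Ne.symm hα, Ne.symm hβ]
  rw [Fintype.sum_prod_type] at hsum
  simp only [Fintype.sum_bool] at hsum
  rw [Finset.sum_eq_single e (fun e' _ hee => by rw [add_comm]; exact hother e' hee) (by simp),
    add_comm, hthis] at hsum
  exact one_ne_zero hsum

variable (Γ) in
/-- The circles of a state through the edge `e`. -/
noncomputable def circlesAt (α : E → Bool) (e : E) : Finset (Γ.Circle α) :=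
  {Γ.circleOf α (Γ.arcAfter (e, false)), Γ.circleOf α (Γ.arcBefore (e, false))}

theorem circleOf_cornerArc_mem_circlesAt (α : E → Bool) (e : E) (b s : Bool) :
    Γ.circleOf α (Γ.cornerArc (e, b) s) ∈ Γ.circlesAt α e := by
  have h1 : ∀ s, Γ.circleOf α (Γ.cornerArc (e, false) s) ∈ Γ.circlesAt α e := by
    rintro (_ | _) <;> simp [circlesAt, cornerArc]
  cases b
  · exact h1 s
  · rw [compatible_iff.mp (compatible_circleOf (Γ := Γ) α) (e, true) s]
    exact h1 _

/-- Lying on an `α`-circle through `e` is a property constant along the strands of `β`: away from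
`e` the strands agree, and at `e` all four ends have it. -/
theorem circleOf_mem_circlesAt (h : ∀ e', e' ≠ e → α e' = β e') {x : Γ.Arc}
    (hx : Γ.circleOf β x ∈ Γ.circlesAt β e) : Γ.circleOf α x ∈ Γ.circlesAt α e := by
  have hP : Γ.Compatible β fun x => (Γ.circleOf α x ∈ Γ.circlesAt α e) := by
    refine compatible_of_const (a := True) h (fun g s _ => ?_) fun b s => ?_
    · simp only [compatible_iff.mp (compatible_circleOf (Γ := Γ) α) g s]
    · simp only [circleOf_cornerArc_mem_circlesAt]
  have h1 : ∀ s, Γ.circleOf α (Γ.cornerArc (e, false) s) ∈ Γ.circlesAt α e :=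
    fun s => circleOf_cornerArc_mem_circlesAt α e false s
  rw [circlesAt, Finset.mem_insert, Finset.mem_singleton] at hx
  rcases hx with hx | hx
  · exact (hP.eq_of_circleOf_eq hx).mpr (h1 true)
  · exact (hP.eq_of_circleOf_eq hx).mpr (h1 false)

/-- Collapsing all `α`-circles through `e` to the one value `none` turns `circleOf α` into a
function compatible with `β`, which still separates the remaining circles. -/
theorem circleOf_eq_of_notMem (h : ∀ e', e' ≠ e → α e' = β e') {x y : Γ.Arc}
    (hx : Γ.circleOf β x ∉ Γ.circlesAt β e) (hxy : Γ.circleOf β x = Γ.circleOf β y) :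
    Γ.circleOf α x = Γ.circleOf α y := by
  classical
  have hP : Γ.Compatible β fun x => (if Γ.circleOf α x ∈ Γ.circlesAt α e then none else
      some (Γ.circleOf α x)) := by
    refine compatible_of_const (a := none) h (fun g s _ => ?_) fun b s => ?_
    · simp only [compatible_iff.mp (compatible_circleOf (Γ := Γ) α) g s]
    · simp only [circleOf_cornerArc_mem_circlesAt, if_true]
  have hx' : Γ.circleOf α x ∉ Γ.circlesAt α e :=
    fun h' => hx (circleOf_mem_circlesAt (fun e' he' => (h e' he').symm) h')
  have hy' : Γ.circleOf α y ∉ Γ.circlesAt α e := fun h' => hx (hxy ▸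
    circleOf_mem_circlesAt (fun e' he' => (h e' he').symm) h')
  simpa [hx', hy'] using hP.eq_of_circleOf_eq hxy

/-- Two states that differ only at `e` share the circles that do not pass through `e`. -/
theorem prod_compl_circlesAt [Finite V] [Finite E] {M : Type*} [CommMonoid M]
    (h : ∀ e', e' ≠ e → α e' = β e')
    (u : Γ.Circle α → M) (w : Γ.Circle β → M)
    (huw : ∀ d, d ∉ Γ.circlesAt β e → u (Γ.circleOf α (Γ.someArc d)) = w d) :
    ∏ c ∈ (Γ.circlesAt α e)ᶜ, u c = ∏ d ∈ (Γ.circlesAt β e)ᶜ, w d := by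
  have h' : ∀ e', e' ≠ e → β e' = α e' := fun e' he' => (h e' he').symm
  have h1 : ∀ d, d ∉ Γ.circlesAt β e → Γ.circleOf α (Γ.someArc d) ∉ Γ.circlesAt α e := by
    intro d hd hd'
    exact hd (circleOf_someArc d ▸ circleOf_mem_circlesAt h' hd')
  have h2 : ∀ c, c ∉ Γ.circlesAt α e → Γ.circleOf β (Γ.someArc c) ∉ Γ.circlesAt β e := by
    intro d hd hd'
    exact hd (circleOf_someArc d ▸ circleOf_mem_circlesAt h hd')
  symm
  refine Finset.prod_nbij' (fun d => Γ.circleOf α (Γ.someArc d))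
    (fun c => Γ.circleOf β (Γ.someArc c)) ?_ ?_ ?_ ?_ ?_
  · simpa using h1
  · simpa using h2
  · intro d hd
    rw [Finset.mem_compl] at hd
    conv_rhs => rw [← circleOf_someArc d]
    exact circleOf_eq_of_notMem h' (by simpa using h1 d hd) (by simp)
  · intro d hd
    rw [Finset.mem_compl] at hd
    conv_rhs => rw [← circleOf_someArc d]
    exact circleOf_eq_of_notMem h (by simpa using h2 d hd) (by simp)
  · intro d hd
    rw [Finset.mem_compl] at hd
    exact (huw d hd).symm

end Neighbors

end RibbonGraph

/-! ### Arithmetic of the color basis -/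

namespace ColorAlgebra

variable (n : ℕ) [NeZero n]

/-- The value of `x` at the color `i`. -/
noncomputable def char (i : Fin n) : ℂ := (lam n ^ (i : ℕ))⁻¹

theorem lam_ne_zero (n : ℕ) : lam n ≠ 0 := Complex.exp_ne_zero _

omit [NeZero n] in
theorem char_ne_zero (i : Fin n) : char n i ≠ 0 := inv_ne_zero (pow_ne_zero _ (lam_ne_zero n))

theorem char_pow_self (i : Fin n) : char n i ^ n = 1 := by
  rw [char, inv_pow, ← pow_mul, mul_comm, pow_mul, lam_pow, one_pow, inv_one]

theorem char_injective : Function.Injective (char n) := fun i j hij =>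
  Fin.ext ((Complex.isPrimitiveRoot_exp n (NeZero.ne n)).pow_inj i.2 j.2 (inv_injective hij))

theorem x_pow_mul_color (k : ℕ) (i : Fin n) : x n ^ k * color n i = char n i ^ k • color n i := by
  have h1 : x n * color n i = char n i • color n i := by
    have h := lam_smul_x_mul_color n i
    rw [smul_mul_assoc] at h
    rw [char, eq_inv_smul_iff₀ (pow_ne_zero _ (lam_ne_zero n)), h]
  induction k with
  | zero => simp
  | succ k ih => rw [pow_succ', mul_assoc, ih, mul_smul_comm, h1, smul_smul, ← pow_succ]

/-- Orthogonality of characters leaves only the exponent `j = 0`. Multiplying this expansion of the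
unit by `x ^ k` yields the color coordinates of all monomials. -/
theorem sum_color : ∑ i, color n i = 1 := by
  have hn : (n : ℂ) ≠ 0 := Nat.cast_ne_zero.mpr (NeZero.ne n)
  have h1 : ∀ j : Fin n, ∑ i : Fin n, lam n ^ ((i : ℕ) * (j : ℕ)) = if j = 0 then (n : ℂ) else 0 := by
    intro j
    split_ifs with hj
    · simp [hj]
    · have hp := Complex.isPrimitiveRoot_exp n (NeZero.ne n)
      have h2 : lam n ^ (j : ℕ) ≠ 1 := hp.pow_ne_one_of_pos_of_lt
        (fun h => hj (Fin.ext (by simpa using h))) j.2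
      have h3 := mul_geom_sum (lam n ^ (j : ℕ)) n
      rw [← pow_mul, mul_comm (j : ℕ), pow_mul, lam_pow, one_pow, sub_self,
        mul_eq_zero, or_iff_right (sub_ne_zero.mpr h2), Finset.sum_range] at h3
      rw [← h3]
      exact Finset.sum_congr rfl fun i _ => by rw [← pow_mul, mul_comm]
  simp only [color]
  rw [← Finset.smul_sum, Finset.sum_comm]
  simp_rw [← Finset.sum_smul, h1]
  simp [hn]

theorem colorBasis_repr_x_pow (k : ℕ) (i : Fin n) :
    (colorBasis n).repr (x n ^ k) i = char n i ^ k := by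
  have h : x n ^ k = ∑ j, char n j ^ k • colorBasis n j := by
    rw [← mul_one (x n ^ k), ← sum_color, Finset.mul_sum]
    exact Finset.sum_congr rfl fun j _ => by rw [x_pow_mul_color, colorBasis_apply]
  rw [h, Module.Basis.repr_sum_self]

/-- The scalar by which the differential multiplies a color on a circle that stays one circle. -/
noncomputable def twist (i : Fin n) : ℂ := (Real.sqrt n : ℂ) * char n i ^ shift n

theorem twist_ne_zero (i : Fin n) : twist n i ≠ 0 := by
  refine mul_ne_zero ?_ (pow_ne_zero _ (char_ne_zero n i))
  rw [Complex.ofReal_ne_zero, Real.sqrt_ne_zero']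
  exact Nat.cast_pos.mpr (NeZero.pos n)

-- The factor `√n` and the shift by `m` make the one-circle scalar a square root of the splitting
-- scalar; the existence of `gauge` rests on this.
omit [NeZero n] in
theorem twist_mul_self (i : Fin n) : twist n i * twist n i = n * char n i ^ (2 * shift n) := by
  have h : ((Real.sqrt n : ℂ)) * (Real.sqrt n : ℂ) = n := by
    rw [← Complex.ofReal_mul, Real.mul_self_sqrt (Nat.cast_nonneg n), Complex.ofReal_natCast]
  rw [twist, mul_mul_mul_comm, h, ← pow_add, two_mul]

/-- Coordinates of the splitting map. -/
theorem sum_char_pow_mul (i j : Fin n) (k : ℕ) :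
    ∑ p : Fin n × Fin n with (p.1 + p.2 : ℕ) ≡ k [MOD n], char n i ^ (p.1 : ℕ) * char n j ^ (p.2 : ℕ) =
      if i = j then n * char n i ^ k else 0 := by
  have hpow : ∀ (i : Fin n) (a b : ℕ), a ≡ b [MOD n] → char n i ^ a = char n i ^ b := by
    intro i a b hab
    rw [← pow_mod_orderOf _ a, ← pow_mod_orderOf _ b]
    exact congrArg _ (hab.of_dvd (orderOf_dvd_of_pow_eq_one (char_pow_self n i)))
  have h1 : ∀ p : Fin n, ∑ q : Fin n, (if (p + q : ℕ) ≡ k [MOD n] then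
      char n i ^ (p : ℕ) * char n j ^ (q : ℕ) else 0) =
      (char n i * (char n j)⁻¹) ^ (p : ℕ) * char n j ^ k := by
    intro p
    -- For fixed `p` this is the only `q` satisfying the congruence, so a geometric sum over `p`
    -- with ratio `char n i / char n j` remains. The ratio is an `n`th root of unity, and it is `1`
    -- only for equal colors.
    let q₀ : Fin n := ⟨(k + (n - p)) % n, Nat.mod_lt _ (NeZero.pos n)⟩
    have hq₀ : (p + q₀ : ℕ) ≡ k [MOD n] := by
      have : (p + (k + (n - p)) : ℕ) = k + n := by have := p.2; omega
      have h2 : (p + q₀ : ℕ) ≡ p + (k + (n - p)) [MOD n] := (Nat.mod_modEq _ _).add_left _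
      rw [this] at h2
      exact h2.trans (by simp [Nat.ModEq])
    rw [Finset.sum_eq_single q₀]
    · rw [if_pos hq₀, ← hpow j _ _ hq₀, pow_add, mul_pow, inv_pow]
      field_simp [char_ne_zero]
    · intro q _ hq
      rw [if_neg]
      intro h
      apply hq
      have h3 : (q : ℕ) ≡ q₀ [MOD n] := Nat.ModEq.add_left_cancel' _ (h.trans hq₀.symm)
      exact Fin.ext (h3.eq_of_lt_of_lt q.2 q₀.2)
    · simp
  rw [Finset.sum_filter, Fintype.sum_prod_type]
  simp_rw [h1, ← Finset.sum_mul]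
  split_ifs with hij
  · subst hij
    simp [mul_inv_cancel₀ (char_ne_zero n i)]
  · have h2 : char n i * (char n j)⁻¹ ≠ 1 := by
      rw [Ne, mul_inv_eq_one₀ (char_ne_zero n j)]
      exact fun h => hij (char_injective n h)
    have h3 := mul_geom_sum (char n i * (char n j)⁻¹) n
    rw [mul_pow, inv_pow, char_pow_self, char_pow_self, inv_one, mul_one, sub_self,
      mul_eq_zero, or_iff_right (sub_ne_zero.mpr h2), Finset.sum_range] at h3
    rw [h3, zero_mul]

end ColorAlgebra

namespace RibbonGraph

open ColorAlgebra

/-! ### The edge differentials in the color basis -/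

section Coefficients

variable {V E : Type*} [Finite V] [Fintype E] (Γ : RibbonGraph V E) (n : ℕ) [NeZero n]
  {α β : E → Bool}

open Classical in
/-- The coordinate of a vector at the coloring `f`; it is `0` if `f` is not a coloring of the
state. -/
noncomputable def coordinate (α : E → Bool) (f : Γ.Arc → Fin n) : Γ.StateSpace n α →ₗ[ℂ] ℂ :=
  if h : Γ.Compatible α f then (Γ.colorBasis n α).coord h.lift else 0

/-- The product of the twists of all circles and of all edges with `1`-smoothing. -/
noncomputable def gauge (α : E → Bool) (f : Γ.Arc → Fin n) : ℂ :=
  (∏ c : Γ.Circle α, twist n (f (Γ.someArc c))) *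
    ∏ e : E, if α e = true then twist n (f (Γ.arcAfter (e, false))) else 1

variable {Γ n}

theorem gauge_ne_zero (f : Γ.Arc → Fin n) : Γ.gauge n α f ≠ 0 := by
  refine mul_ne_zero (Finset.prod_ne_zero_iff.mpr fun c _ => twist_ne_zero n _)
    (Finset.prod_ne_zero_iff.mpr fun e _ => ?_)
  split_ifs
  · exact twist_ne_zero n _
  · exact one_ne_zero

theorem coordinate_of_compatible {f : Γ.Arc → Fin n} (hf : Γ.Compatible α f)
    (u : Γ.StateSpace n α) : Γ.coordinate n α f u = (Γ.colorBasis n α).repr u hf.lift := by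
  rw [coordinate, dif_pos hf, Module.Basis.coord_apply]

theorem coordinate_of_not_compatible {f : Γ.Arc → Fin n} (hf : ¬ Γ.Compatible α f)
    (u : Γ.StateSpace n α) : Γ.coordinate n α f u = 0 := by
  rw [coordinate, dif_neg hf, LinearMap.zero_apply]

theorem coordinate_tprod {f : Γ.Arc → Fin n} (hf : Γ.Compatible α f) (k : Γ.Circle α → ℕ) :
    Γ.coordinate n α f (⨂ₜ[ℂ] c, x n ^ k c) = ∏ c, char n (hf.lift c) ^ k c := by
  rw [coordinate_of_compatible hf, colorBasis, Basis.piTensorProduct_repr_tprod_apply]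
  exact Finset.prod_congr rfl fun c _ => colorBasis_repr_x_pow n _ _

theorem monomialBasis_apply (a : Γ.Circle α → Fin n) :
    Γ.monomialBasis n α a = ⨂ₜ[ℂ] c, x n ^ (a c : ℕ) := by
  rw [monomialBasis, Basis.piTensorProduct_apply]
  simp only [ColorAlgebra.monomialBasis_apply]

omit [NeZero n] in
theorem gauge_eq {f : Γ.Arc → Fin n} (hf : Γ.Compatible α f) (e : E) :
    Γ.gauge n α f = (∏ c ∈ Γ.circlesAt α e, twist n (hf.lift c)) *
      (∏ c ∈ (Γ.circlesAt α e)ᶜ, twist n (hf.lift c)) *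
      ∏ e : E, if α e = true then twist n (f (Γ.arcAfter (e, false))) else 1 := by
  rw [Finset.prod_mul_prod_compl, gauge]
  simp only [hf.apply_someArc]

/-- The edge differential in coordinates. -/
theorem coordinate_edgeMap {e : E} (hα : α e = false) (hβ : β e = true)
    (h : ∀ e', e' ≠ e → α e' = β e') {f : Γ.Arc → Fin n} (hf : Γ.Compatible β f)
    (u : Γ.StateSpace n α) :
    Γ.coordinate n β f (Γ.edgeMap n α β e u) =
      Γ.gauge n β f / Γ.gauge n α f * Γ.coordinate n α f u := by
  classical
  have hne : α e ≠ β e := by simp [hα, hβ]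
  suffices H : Γ.coordinate n β f ∘ₗ Γ.edgeMap n α β e =
      (Γ.gauge n β f / Γ.gauge n α f) • Γ.coordinate n α f from LinearMap.congr_fun H u
  refine (Γ.monomialBasis n α).ext fun a => ?_
  rw [LinearMap.comp_apply, LinearMap.smul_apply, edgeMap, Module.Basis.constr_basis,
    monomialBasis_apply, smul_eq_mul]
  have hE : (∏ e : E, if β e = true then twist n (f (Γ.arcAfter (e, false))) else 1) =
      twist n (f (Γ.arcAfter (e, false))) *
      ∏ e : E, if α e = true then twist n (f (Γ.arcAfter (e, false))) else 1 := by
    rw [← Finset.mul_prod_erase _ _ (Finset.mem_univ e),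
      ← Finset.mul_prod_erase Finset.univ (fun e => if α e = true then _ else (1 : ℂ))
        (Finset.mem_univ e), if_pos hβ, if_neg (by simp [hα]), one_mul]
    congr 1
    refine Finset.prod_congr rfl fun e' he' => ?_
    rw [h e' (Finset.ne_of_mem_erase he')]
  have hE0 : (∏ e : E, if α e = true then twist n (f (Γ.arcAfter (e, false))) else 1) ≠ 0 := by
    refine Finset.prod_ne_zero_iff.mpr fun e _ => ?_
    split_ifs
    exacts [twist_ne_zero n _, one_ne_zero]
  -- the exponents away from `e`
  have hrest : ∀ k : Γ.Circle β → ℕ, (∀ d, d ∉ Γ.circlesAt β e →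
      k d = a (Γ.circleOf α (Γ.someArc d))) → ∏ d, char n (hf.lift d) ^ k d =
      (∏ d ∈ Γ.circlesAt β e, char n (hf.lift d) ^ k d) *
      ∏ d ∈ (Γ.circlesAt β e)ᶜ, char n (hf.lift d) ^ (a (Γ.circleOf α (Γ.someArc d)) : ℕ) := by
    intro k hk
    rw [← Finset.prod_mul_prod_compl (Γ.circlesAt β e)]
    congr 1
    refine Finset.prod_congr rfl fun d hd => ?_
    rw [hk d (Finset.mem_compl.mp hd)]
  -- the right hand side for a coloring of both states
  have hR : ∀ hfα : Γ.Compatible α f, Γ.gauge n β f / Γ.gauge n α f *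
      Γ.coordinate n α f (⨂ₜ[ℂ] c, x n ^ (a c : ℕ)) =
      (∏ d ∈ Γ.circlesAt β e, twist n (hf.lift d)) * twist n (f (Γ.arcAfter (e, false))) *
      (∏ c ∈ Γ.circlesAt α e, twist n (hfα.lift c))⁻¹ *
      ((∏ c ∈ Γ.circlesAt α e, char n (hfα.lift c) ^ (a c : ℕ)) *
      ∏ d ∈ (Γ.circlesAt β e)ᶜ, char n (hf.lift d) ^ (a (Γ.circleOf α (Γ.someArc d)) : ℕ)) := by
    intro hfα
    have hl : ∀ d, hfα.lift (Γ.circleOf α (Γ.someArc d)) = hf.lift d := fun d => by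
      rw [Compatible.lift_circleOf, hf.apply_someArc]
    have h1 : ∏ c ∈ (Γ.circlesAt α e)ᶜ, twist n (hfα.lift c) =
        ∏ d ∈ (Γ.circlesAt β e)ᶜ, twist n (hf.lift d) :=
      prod_compl_circlesAt h _ _ fun d _ => by rw [hl]
    have h2 : ∏ c ∈ (Γ.circlesAt α e)ᶜ, char n (hfα.lift c) ^ (a c : ℕ) =
        ∏ d ∈ (Γ.circlesAt β e)ᶜ, char n (hf.lift d) ^ (a (Γ.circleOf α (Γ.someArc d)) : ℕ) :=
      prod_compl_circlesAt h _ _ fun d _ => by rw [hl]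
    have h3 : ∏ d ∈ (Γ.circlesAt β e)ᶜ, twist n (hf.lift d) ≠ 0 :=
      Finset.prod_ne_zero_iff.mpr fun _ _ => twist_ne_zero n _
    have h4 : ∏ c ∈ Γ.circlesAt α e, twist n (hfα.lift c) ≠ 0 :=
      Finset.prod_ne_zero_iff.mpr fun _ _ => twist_ne_zero n _
    rw [coordinate_tprod hfα, ← Finset.prod_mul_prod_compl (Γ.circlesAt α e), gauge_eq hf e,
      gauge_eq hfα e, h1, h2, hE]
    congr 1
    field_simp
  -- If `β` has only one circle at `e`, then `f` is monochromatic there and hence also a coloring of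
  -- `α`.
  have hmono : Γ.circleOf β (Γ.arcAfter (e, false)) = Γ.circleOf β (Γ.arcBefore (e, false)) →
      ∃ hfα : Γ.Compatible α f,
        hfα.lift (Γ.circleOf α (Γ.arcBefore (e, false))) = f (Γ.arcAfter (e, false)) := by
    intro hd
    have hm : Γ.Mono f e := hf.eq_of_circleOf_eq hd
    refine ⟨hf.of_mono fun e' he' => ?_, hm.symm⟩
    by_contra hh
    exact he' (h e' fun h' => hh (h' ▸ hm)).symm
  have ht := twist_ne_zero n (f (Γ.arcAfter (e, false)))
  by_cases hc : Γ.circleOf α (Γ.arcAfter (e, false)) = Γ.circleOf α (Γ.arcBefore (e, false))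
  · by_cases hd : Γ.circleOf β (Γ.arcAfter (e, false)) = Γ.circleOf β (Γ.arcBefore (e, false))
    -- One circle stays one circle: the circle factors of the gauges agree, and the new `1`-entry at
    -- `e` supplies the single `twist`.
    · obtain ⟨hfα, hm⟩ := hmono hd
      have hAα : Γ.circlesAt α e = {Γ.circleOf α (Γ.arcAfter (e, false))} := by
        simp [circlesAt, ← hc]
      have hAβ : Γ.circlesAt β e = {Γ.circleOf β (Γ.arcAfter (e, false))} := by
        simp [circlesAt, ← hd]
      simp only [ne_eq, hc, hd, not_true_eq_false, if_false]
      rw [map_smul, coordinate_tprod hf, hrest, hR hfα, hAα, hAβ, ← hd, ← hc]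
      · simp only [Finset.prod_singleton, Compatible.lift_circleOf, if_true, smul_eq_mul]
        field_simp
        rw [twist, pow_add]
        ring
      · intro d hd'
        rw [if_neg]
        rintro rfl
        simp [circlesAt] at hd'
    -- One circle splits: the additional circle and the new `1`-entry supply two twists. If the two
    -- new circles have different colors, both sides vanish.
    · have hAα : Γ.circlesAt α e = {Γ.circleOf α (Γ.arcAfter (e, false))} := by
        simp [circlesAt, ← hc]
      simp only [ne_eq, hc, hd, not_true_eq_false, not_false_eq_true, if_true, if_false]
      rw [map_sum]
      have hs : ∀ p : Fin n × Fin n, Γ.coordinate n β f (⨂ₜ[ℂ] d, x n ^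
          (if d = Γ.circleOf β (Γ.arcAfter (e, false)) then (p.1 : ℕ) else
            if d = Γ.circleOf β (Γ.arcBefore (e, false)) then (p.2 : ℕ) else
              a (Γ.circleOf α (Γ.someArc d)))) =
          char n (f (Γ.arcAfter (e, false))) ^ (p.1 : ℕ) *
            char n (f (Γ.arcBefore (e, false))) ^ (p.2 : ℕ) *
          ∏ d ∈ (Γ.circlesAt β e)ᶜ,
            char n (hf.lift d) ^ (a (Γ.circleOf α (Γ.someArc d)) : ℕ) := by
        intro p
        rw [coordinate_tprod hf, hrest, circlesAt, Finset.prod_pair hd]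
        · simp [Ne.symm hd]
        · intro d hd'
          simp only [circlesAt, Finset.mem_insert, Finset.mem_singleton, not_or] at hd'
          simp [hd']
      simp_rw [hs, ← Finset.sum_mul]
      rw [sum_char_pow_mul]
      split_ifs with hm
      · have hfα : Γ.Compatible α f := hf.of_mono fun e' he' => by
          by_contra hh
          exact he' (h e' fun h' => hh (h' ▸ hm)).symm
        have hAβ : Γ.circlesAt β e = {Γ.circleOf β (Γ.arcAfter (e, false)),
          Γ.circleOf β (Γ.arcBefore (e, false))} := rfl
        rw [hR hfα, hAα, ← hc, hAβ, Finset.prod_pair hd]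
        simp only [Finset.prod_singleton, Compatible.lift_circleOf, ← hm]
        field_simp
        rw [pow_two, twist_mul_self, pow_add]
        ring
      · rw [coordinate_of_not_compatible fun hfα => hm (hfα.mono hf hne), zero_mul, mul_zero]
  · have hd := circleOf_eq_of_circleOf_ne h hne hc
    obtain ⟨hfα, hm⟩ := hmono hd
    have hAβ : Γ.circlesAt β e = {Γ.circleOf β (Γ.arcAfter (e, false))} := by
      simp [circlesAt, ← hd]
    simp only [ne_eq, hc, not_false_eq_true, if_true]
    rw [coordinate_tprod hf, hrest, hR hfα, hAβ]
    · conv_rhs => rw [circlesAt, Finset.prod_pair hc, Finset.prod_pair hc]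
      simp only [Finset.prod_singleton, Compatible.lift_circleOf, if_true, hm]
      field_simp
      rw [pow_add]
      ring
    · intro d hd'
      rw [if_neg]
      rintro rfl
      simp [circlesAt] at hd'

end Coefficients

end RibbonGraph

namespace RibbonGraph

open ColorAlgebra

/-! ### Cochains on the cube -/

section Cube

variable {E : Type*} [Fintype E] [LinearOrder E]

/-- The sign of the edge of the cube that changes the entry `e`. -/
def cubeSign (β : E → Bool) (e : E) : ℂ :=
  (-1) ^ (Finset.univ.filter fun e' => e' < e ∧ β e' = true).card

/-- The signed sum over the predecessors of a vertex of the cube. -/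
def cubeDiff (t : (E → Bool) → ℂ) (β : E → Bool) : ℂ :=
  ∑ e, if β e = true then cubeSign β e * t (Function.update β e false) else 0

theorem cubeSign_mul_self (β : E → Bool) (e : E) : cubeSign β e * cubeSign β e = 1 := by
  rw [cubeSign, ← mul_pow]
  simp

theorem cubeSign_update_of_le (β : E → Bool) {e e' : E} (h : e' ≤ e) (b : Bool) :
    cubeSign (Function.update β e b) e' = cubeSign β e' := by
  rw [cubeSign, cubeSign]
  congr 2
  refine Finset.filter_congr fun a _ => and_congr_right fun ha => ?_
  rw [Function.update_of_ne (ha.trans_le h).ne]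

theorem cubeSign_update_of_lt {β : E → Bool} {e e' : E} (h : e < e') (he : β e = true) :
    cubeSign (Function.update β e false) e' = -cubeSign β e' := by
  have h1 : (Finset.univ.filter fun a => a < e' ∧ Function.update β e false a = true) =
      (Finset.univ.filter fun a => a < e' ∧ β a = true).erase e := by
    ext a
    by_cases ha : a = e <;> simp [ha, Function.update_apply]
  have h2 : e ∈ Finset.univ.filter fun a => a < e' ∧ β a = true := by simp [h, he]
  rw [cubeSign, cubeSign, h1, ← Finset.card_erase_add_one h2, pow_succ]
  ring

theorem cubeSign_mul_cubeSign {β : E → Bool} {e e' : E} (h : e ≠ e') (he : β e = true)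
    (he' : β e' = true) : cubeSign β e * cubeSign (Function.update β e false) e' =
      -(cubeSign β e' * cubeSign (Function.update β e' false) e) := by
  rcases lt_or_gt_of_ne h with h | h
  · rw [cubeSign_update_of_lt h he, cubeSign_update_of_le _ h.le]
    ring
  · rw [cubeSign_update_of_lt h he', cubeSign_update_of_le _ h.le]
    ring

/-- Lowering two entries in the two possible orders gives opposite signs, so the double sum is
antisymmetric and equals its own negative. -/
theorem cubeDiff_cubeDiff (t : (E → Bool) → ℂ) (γ : E → Bool) : cubeDiff (cubeDiff t) γ = 0 := by
  let F : E → E → ℂ := fun e e' => if γ e = true then cubeSign γ e *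
    (if Function.update γ e false e' = true then cubeSign (Function.update γ e false) e' *
      t (Function.update (Function.update γ e false) e' false) else 0) else 0
  have hF : ∀ e e', F e e' = -F e' e := by
    intro e e'
    by_cases h : e = e'
    · subst h
      simp [F]
    · simp only [F, Function.update_of_ne h, Function.update_of_ne (Ne.symm h)]
      by_cases he : γ e = true <;> by_cases he' : γ e' = true <;> simp only [he, he', if_true]
      · rw [← mul_assoc, ← mul_assoc, cubeSign_mul_cubeSign h he he', Function.update_comm h]
        ring
      all_goals simp
  have h1 : cubeDiff (cubeDiff t) γ = ∑ e, ∑ e', F e e' := by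
    simp only [cubeDiff, F]
    refine Finset.sum_congr rfl fun e _ => ?_
    split_ifs
    · rw [Finset.mul_sum]
    · simp
  have h2 : ∑ e, ∑ e', F e e' = -∑ e, ∑ e', F e e' := by
    conv_lhs => rw [Finset.sum_comm]
    simp_rw [← Finset.sum_neg_distrib]
    exact Finset.sum_congr rfl fun e _ => Finset.sum_congr rfl fun e' _ => hF _ _
  rw [h1]
  exact self_eq_neg.mp h2

/-- Contraction of the cube along the direction `e₀`. -/
def cubeContract (e₀ : E) (t : (E → Bool) → ℂ) (α : E → Bool) : ℂ :=
  if α e₀ = false then cubeSign α e₀ * t (Function.update α e₀ true) else 0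

/-- This is the homotopy identity `dh + hd = 1` at one vertex. The cocycle condition is required
only where `hd` evaluates it, since the coordinates of a cocycle are known to satisfy it only at
compatible states. -/
theorem cubeDiff_cubeContract {e₀ : E} {t : (E → Bool) → ℂ} {β : E → Bool}
    (h : β e₀ = false → cubeDiff t (Function.update β e₀ true) = 0) :
    cubeDiff (cubeContract e₀ t) β = t β := by
  by_cases h0 : β e₀ = true
  -- The contraction vanishes wherever the entry at `e₀` is `1`, so only lowering `e₀` itself
  -- contributes.
  · rw [cubeDiff, Finset.sum_eq_single e₀]
    · have h1 : Function.update β e₀ true = β := by rw [← h0, Function.update_eq_self]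
      simp only [h0, if_true, cubeContract, Function.update_self, Function.update_idem, h1]
      rw [cubeSign_update_of_le _ le_rfl, ← mul_assoc, cubeSign_mul_self, one_mul]
    · intro e _ he
      simp [cubeContract, Function.update_of_ne (Ne.symm he), h0]
    · simp
  · have h0' : β e₀ = false := by simpa using h0
    have h1 := h h0'
    have h2 : Function.update β e₀ false = β := by rw [← h0', Function.update_eq_self]
    -- In the cocycle condition at `β` with `e₀` raised, the `e₀` term is `± t β`; the other terms
    -- are, up to sign, those of the contracted sum.
    rw [cubeDiff, ← Finset.add_sum_erase _ _ (Finset.mem_univ e₀)] at h1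
    simp only [Function.update_self, if_true, Function.update_idem, h2] at h1
    rw [cubeSign_update_of_le _ le_rfl] at h1
    have h3 : cubeDiff (cubeContract e₀ t) β = -(cubeSign β e₀ *
        ∑ e ∈ Finset.univ.erase e₀, if Function.update β e₀ true e = true then
          cubeSign (Function.update β e₀ true) e *
            t (Function.update (Function.update β e₀ true) e false) else 0) := by
      rw [cubeDiff, ← Finset.add_sum_erase _ _ (Finset.mem_univ e₀), if_neg h0, zero_add,
        Finset.mul_sum, ← Finset.sum_neg_distrib]
      refine Finset.sum_congr rfl fun e he => ?_
      have hne := Finset.ne_of_mem_erase he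
      rw [Function.update_of_ne hne]
      split_ifs with hβ
      · rw [cubeContract, Function.update_of_ne (Ne.symm hne), if_pos h0',
          Function.update_comm hne, ← mul_assoc, ← mul_assoc, ← neg_mul]
        congr 1
        rcases lt_or_gt_of_ne hne with hlt | hlt
        · rw [cubeSign_update_of_lt hlt hβ, cubeSign_update_of_le _ hlt.le]
          ring
        · have h4 := cubeSign_update_of_lt (β := Function.update β e₀ true) hlt (by simp)
          rw [Function.update_idem, h2] at h4
          rw [cubeSign_update_of_le _ hlt.le, h4]
          ring
      · simp
    rw [h3, eq_neg_of_add_eq_zero_right h1]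
    rw [mul_neg, neg_neg, ← mul_assoc, cubeSign_mul_self, one_mul]

theorem weight_update_true {β : E → Bool} {e : E} (he : β e = false) :
    weight (Function.update β e true) = weight β + 1 := by
  have h1 : 0 < weight (Function.update β e true) :=
    Finset.card_pos.mpr ⟨e, by simp⟩
  have h2 := weight_update_false (i := weight (Function.update β e true) - 1) (e := e)
    (β := Function.update β e true) (by omega) (by simp)
  rw [Function.update_idem, ← he, Function.update_eq_self] at h2
  rw [← he] at *
  omega

end Cube

/-! ### Homology of the filtered complex -/

section Homology

variable {V E : Type*} [Finite V] [Fintype E] (Γ : RibbonGraph V E) (n : ℕ) [NeZero n]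
  {α β : E → Bool}

/-- The coordinate at the coloring `f`, normalized such that the edge differentials have
coefficients `0` and `1`. -/
noncomputable def normCoordinate (α : E → Bool) (f : Γ.Arc → Fin n) : Γ.StateSpace n α →ₗ[ℂ] ℂ :=
  (Γ.gauge n α f)⁻¹ • Γ.coordinate n α f

variable {Γ n}

theorem normCoordinate_eq_zero_iff {f : Γ.Arc → Fin n} {u : Γ.StateSpace n α} :
    Γ.normCoordinate n α f u = 0 ↔ Γ.coordinate n α f u = 0 := by
  rw [normCoordinate, LinearMap.smul_apply, smul_eq_mul, mul_eq_zero,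
    or_iff_right (inv_ne_zero (gauge_ne_zero f))]

theorem normCoordinate_of_not_compatible {f : Γ.Arc → Fin n} (hf : ¬ Γ.Compatible α f)
    (u : Γ.StateSpace n α) : Γ.normCoordinate n α f u = 0 :=
  normCoordinate_eq_zero_iff.mpr (coordinate_of_not_compatible hf u)

theorem normCoordinate_edgeMap {e : E} (hα : α e = false) (hβ : β e = true)
    (h : ∀ e', e' ≠ e → α e' = β e') {f : Γ.Arc → Fin n} (hf : Γ.Compatible β f)
    (u : Γ.StateSpace n α) :
    Γ.normCoordinate n β f (Γ.edgeMap n α β e u) = Γ.normCoordinate n α f u := by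
  have h1 := gauge_ne_zero (α := α) f
  have h2 := gauge_ne_zero (α := β) f
  rw [normCoordinate, LinearMap.smul_apply, coordinate_edgeMap hα hβ h hf, normCoordinate,
    LinearMap.smul_apply, smul_eq_mul, smul_eq_mul]
  field_simp

theorem stateSpace_ext {u v : Γ.StateSpace n α}
    (h : ∀ f, Γ.Compatible α f → Γ.coordinate n α f u = Γ.coordinate n α f v) : u = v := by
  refine (Γ.colorBasis n α).ext_elem fun I => ?_
  have h1 := h _ ((Γ.compatibleEquiv α) I).2
  rw [coordinate_of_compatible ((Γ.compatibleEquiv α) I).2,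
    coordinate_of_compatible ((Γ.compatibleEquiv α) I).2] at h1
  have h2 : ((Γ.compatibleEquiv α) I).2.lift = I := (Γ.compatibleEquiv α).symm_apply_apply I
  rwa [h2] at h1

theorem exists_coordinate_eq (t : (Γ.Arc → Fin n) → ℂ) (ht : ∀ f, ¬ Γ.Compatible α f → t f = 0) :
    ∃ u : Γ.StateSpace n α, ∀ f, Γ.coordinate n α f u = t f := by
  refine ⟨(Γ.colorBasis n α).equivFun.symm fun I => t (I ∘ Γ.circleOf α), fun f => ?_⟩
  by_cases hf : Γ.Compatible α f
  · rw [coordinate_of_compatible hf, ← Module.Basis.equivFun_apply, LinearEquiv.apply_symm_apply]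
    rfl
  · rw [coordinate_of_not_compatible hf, ht f hf]

theorem exists_normCoordinate_eq (t : (Γ.Arc → Fin n) → ℂ)
    (ht : ∀ f, ¬ Γ.Compatible α f → t f = 0) :
    ∃ u : Γ.StateSpace n α, ∀ f, Γ.normCoordinate n α f u = t f := by
  obtain ⟨u, hu⟩ := exists_coordinate_eq (α := α) (fun f => Γ.gauge n α f * t f)
    fun f hf => by rw [ht f hf, mul_zero]
  refine ⟨u, fun f => ?_⟩
  rw [normCoordinate, LinearMap.smul_apply, hu, smul_eq_mul, inv_mul_cancel_left₀ (gauge_ne_zero f)]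

variable (Γ n) in
/-- The normalized coordinates of a chain. -/
noncomputable def chainCoordinate (i : ℕ) (f : Γ.Arc → Fin n) (α : E → Bool) :
    Γ.Chain n i →ₗ[ℂ] ℂ :=
  -- The value `0` in the other weights makes this a function on the whole cube, to which `cubeDiff`
  -- applies.
  if h : weight α = i then Γ.normCoordinate n α f ∘ₗ LinearMap.proj
    (⟨α, h⟩ : {α : E → Bool // weight α = i}) else 0

theorem chainCoordinate_of_weight {i : ℕ} (f : Γ.Arc → Fin n) (h : weight α = i)
    (z : Γ.Chain n i) : Γ.chainCoordinate n i f α z = Γ.normCoordinate n α f (z ⟨α, h⟩) := by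
  rw [chainCoordinate, dif_pos h]
  rfl

theorem chainCoordinate_of_weight_ne {i : ℕ} (f : Γ.Arc → Fin n) (h : weight α ≠ i)
    (z : Γ.Chain n i) : Γ.chainCoordinate n i f α z = 0 := by
  rw [chainCoordinate, dif_neg h, LinearMap.zero_apply]

theorem chainCoordinate_of_not_compatible {i : ℕ} {f : Γ.Arc → Fin n} (hf : ¬ Γ.Compatible α f)
    (z : Γ.Chain n i) : Γ.chainCoordinate n i f α z = 0 := by
  by_cases h : weight α = i
  · rw [chainCoordinate_of_weight f h, normCoordinate_of_not_compatible hf]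
  · rw [chainCoordinate_of_weight_ne f h]

theorem chain_ext {i : ℕ} {z w : Γ.Chain n i} (h : ∀ f α, weight α = i → Γ.Compatible α f →
    Γ.chainCoordinate n i f α z = Γ.chainCoordinate n i f α w) : z = w := by
  funext ⟨α, hα⟩
  rw [← sub_eq_zero]
  refine stateSpace_ext fun f hf => ?_
  rw [map_zero, ← normCoordinate_eq_zero_iff, map_sub, ← chainCoordinate_of_weight f hα,
    ← chainCoordinate_of_weight f hα, h f α hα hf, sub_self]

theorem exists_chainCoordinate_eq {i : ℕ} (t : (Γ.Arc → Fin n) → (E → Bool) → ℂ)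
    (ht : ∀ f α, t f α ≠ 0 → weight α = i ∧ Γ.Compatible α f) :
    ∃ z : Γ.Chain n i, ∀ f α, Γ.chainCoordinate n i f α z = t f α := by
  choose u hu using fun α : E → Bool => exists_normCoordinate_eq (Γ := Γ) (α := α) (fun f => t f α)
    fun f hf => by_contra fun h => hf (ht f α h).2
  refine ⟨fun α => u α.1, fun f α => ?_⟩
  by_cases h : weight α = i
  · rw [chainCoordinate_of_weight f h, hu]
  · rw [chainCoordinate_of_weight_ne f h]
    by_contra h'
    exact h (ht f α (Ne.symm h')).1

variable [LinearOrder E]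

/-- The differential in coordinates. -/
theorem chainCoordinate_differential {i : ℕ} {f : Γ.Arc → Fin n} (hf : Γ.Compatible β f)
    (z : Γ.Chain n i) : Γ.chainCoordinate n (i + 1) f β (Γ.differential n i z) =
      cubeDiff (fun α => Γ.chainCoordinate n i f α z) β := by
  by_cases h : weight β = i + 1
  · rw [chainCoordinate_of_weight f h, differential, LinearMap.pi_apply, LinearMap.sum_apply,
      map_sum, cubeDiff, ← Finset.sum_filter, ← Finset.sum_subtype_eq_sum_filter]
    simp only [Finset.subtype_univ]
    refine Finset.sum_congr rfl fun e _ => ?_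
    rw [LinearMap.smul_apply, map_smul, LinearMap.comp_apply, LinearMap.proj_apply,
      normCoordinate_edgeMap (by simp) e.2 (fun e' he' => by simp [he']) hf,
      chainCoordinate_of_weight f (weight_update_false h e.2), cubeSign, smul_eq_mul]
  · rw [chainCoordinate_of_weight_ne f h, cubeDiff]
    refine (Finset.sum_eq_zero fun e _ => ?_).symm
    split_ifs with he
    · rw [chainCoordinate_of_weight_ne, mul_zero]
      intro h'
      apply h
      rw [← h', ← weight_update_true (e := e) (by simp), Function.update_idem, ← he,
        Function.update_eq_self]
    · rfl

theorem differential_comp_differential (i : ℕ) :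
    Γ.differential n (i + 1) ∘ₗ Γ.differential n i = 0 := by
  refine LinearMap.ext fun z => chain_ext fun f γ _ hf => ?_
  rw [LinearMap.comp_apply, chainCoordinate_differential hf, LinearMap.zero_apply, map_zero,
    ← cubeDiff_cubeDiff (fun α => Γ.chainCoordinate n i f α z) γ]
  refine Finset.sum_congr rfl fun e _ => ?_
  split_ifs with he
  · congr 1
    by_cases h : Γ.Compatible (Function.update γ e false) f
    · exact chainCoordinate_differential h z
    -- The coordinate formula for the differential is not available at an incompatible state, so
    -- both sides are shown to vanish. If lowering `e` destroys compatibility, then `f` is not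
    -- monochromatic at `e`, and lowering a further entry cannot restore it.
    · refine (chainCoordinate_of_not_compatible h _).trans ?_
      refine (Finset.sum_eq_zero fun e' _ => ?_).symm
      split_ifs with he'
      · have hee : e ≠ e' := by
          rintro rfl
          simp at he'
        refine mul_eq_zero_of_right _ (chainCoordinate_of_not_compatible ?_ _)
        intro h'
        refine h (hf.of_mono fun e'' he'' => ?_)
        by_cases hh : e'' = e
        · subst hh
          exact hf.mono h' (by rw [Function.update_of_ne hee]; simp [he])
        · simp [hh] at he''
      · rfl
  · rfl

/-- For each coloring with a monochromatic edge, one such edge is chosen and the cocycle is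
contracted in that direction. The primitives for the various `f` assemble to a chain because
contraction preserves compatibility. -/
theorem mem_boundaries {i : ℕ} {z : Γ.Chain n i} (hz : Γ.differential n i z = 0)
    (h : ∀ f, (∀ e, ¬ Γ.Mono f e) → ∀ α, Γ.chainCoordinate n i f α z = 0) :
    z ∈ Γ.boundaries n i := by
  classical
  let y : (Γ.Arc → Fin n) → (E → Bool) → ℂ := fun f =>
    if hf : ∃ e, Γ.Mono f e then
      cubeContract hf.choose fun α => Γ.chainCoordinate n i f α z else 0
  have hdy : ∀ f β, Γ.Compatible β f → cubeDiff (y f) β = Γ.chainCoordinate n i f β z := by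
    intro f β hβ
    by_cases hf : ∃ e, Γ.Mono f e
    · simp only [y, dif_pos hf]
      refine cubeDiff_cubeContract fun h0 => ?_
      rw [← chainCoordinate_differential, hz, map_zero]
      refine hβ.of_mono fun e he => ?_
      by_cases hh : e = hf.choose
      · rw [hh]
        exact hf.choose_spec
      · simp [hh] at he
    · simp only [y, dif_neg hf]
      rw [h f (not_exists.mp hf)]
      simp [cubeDiff]
  have hy : ∀ f α, y f α ≠ 0 → weight α + 1 = i ∧ Γ.Compatible α f := by
    intro f α hα
    by_cases hf : ∃ e, Γ.Mono f e
    · simp only [y, dif_pos hf, cubeContract] at hα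
      have h0 : α hf.choose = false := by
        by_contra h0
        exact hα (if_neg h0)
      rw [if_pos h0] at hα
      refine ⟨?_, ?_⟩
      · rw [← weight_update_true h0]
        by_contra h1
        rw [chainCoordinate_of_weight_ne f h1, mul_zero] at hα
        exact hα rfl
      · by_contra h1
        rw [chainCoordinate_of_not_compatible, mul_zero] at hα
        · exact hα rfl
        · refine fun h2 => h1 (h2.of_mono fun e he => ?_)
          by_cases hh : e = hf.choose
          · rw [hh]
            exact hf.choose_spec
          · simp [hh] at he
    · simp [y, dif_neg hf] at hα
  cases i with
  -- Below degree `0` there is no room for a primitive: `y` vanishes by weight, and therefore so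
  -- does `z`.
  | zero =>
    rw [boundaries, Submodule.mem_bot]
    refine chain_ext fun f β _ hf => ?_
    rw [← hdy f β hf, map_zero]
    refine Finset.sum_eq_zero fun e _ => ?_
    have h1 : y f (Function.update β e false) = 0 := by
      by_contra h1
      exact absurd (hy _ _ h1).1 (Nat.succ_ne_zero _)
    simp [h1]
  | succ i =>
    obtain ⟨w, hw⟩ := exists_chainCoordinate_eq (i := i) y fun f α hα =>
      ⟨Nat.succ_injective (hy f α hα).1, (hy f α hα).2⟩
    refine ⟨w, chain_ext fun f β _ hf => ?_⟩
    rw [chainCoordinate_differential hf, ← hdy f β hf]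
    simp only [hw]

/-- A coloring without monochromatic edges is compatible with at most one state, so no edge map
reaches it. -/
theorem chainCoordinate_eq_zero_of_mem_boundaries {i : ℕ} {z : Γ.Chain n i}
    (hz : z ∈ Γ.boundaries n i) {f : Γ.Arc → Fin n} (hf : ∀ e, ¬ Γ.Mono f e) (β : E → Bool) :
    Γ.chainCoordinate n i f β z = 0 := by
  cases i with
  | zero =>
    rw [boundaries, Submodule.mem_bot] at hz
    rw [hz, map_zero]
  | succ i =>
    obtain ⟨y, rfl⟩ := hz
    by_cases hβ : Γ.Compatible β f
    · rw [chainCoordinate_differential hβ]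
      refine Finset.sum_eq_zero fun e _ => ?_
      split_ifs with he
      · refine mul_eq_zero_of_right _ (chainCoordinate_of_not_compatible ?_ _)
        exact fun h => hf e (hβ.mono h (by simp [he]))
      · rfl
    · exact chainCoordinate_of_not_compatible hβ _

end Homology

end RibbonGraph

namespace RibbonGraph

open ColorAlgebra

/-! ### Harmonic colorings -/

section Harmonic

variable {V E : Type*} [Finite V] [Fintype E] {Γ : RibbonGraph V E} {n : ℕ} [NeZero n]
  {α β : E → Bool}

open Classical in
theorem coordinate_colorBasis {f g : Γ.Arc → Fin n} (hf : Γ.Compatible α f) :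
    Γ.coordinate n α g (Γ.colorBasis n α hf.lift) = if g = f then 1 else 0 := by
  by_cases hg : Γ.Compatible α g
  · rw [coordinate_of_compatible hg, Module.Basis.repr_self, Finsupp.single_apply]
    have h : hf.lift = hg.lift ↔ g = f := by
      have h1 := (Γ.compatibleEquiv (X := Fin n) α).symm.injective.eq_iff (a := ⟨f, hf⟩)
        (b := ⟨g, hg⟩)
      rw [Subtype.mk.injEq] at h1
      exact h1.trans eq_comm
    simp only [h]
  · rw [coordinate_of_not_compatible hg, if_neg]
    rintro rfl
    exact hg hf

/-- The adjoint of an edge differential in coordinates. -/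
theorem coordinate_adjoint_edgeMap {e : E} (hα : α e = false) (hβ : β e = true)
    (h : ∀ e', e' ≠ e → α e' = β e') {f : Γ.Arc → Fin n} (hf : Γ.Compatible α f)
    (v : Γ.StateSpace n β) :
    Γ.coordinate n α f (Γ.adjoint n (Γ.edgeMap n α β e) v) =
      (starRingEnd ℂ) (Γ.gauge n β f / Γ.gauge n α f) * Γ.coordinate n β f v := by
  classical
  -- A color basis vector maps to a multiple of a color basis vector, so at most one matrix entry is
  -- nonzero for each `f`.
  have hM : ∀ J : Γ.Circle β → Fin n, (starRingEnd ℂ)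
      ((Γ.colorBasis n β).repr (Γ.edgeMap n α β e (Γ.colorBasis n α hf.lift)) J) =
      if J ∘ Γ.circleOf β = f then (starRingEnd ℂ) (Γ.gauge n β f / Γ.gauge n α f) else 0 := by
    intro J
    have h1 := coordinate_edgeMap hα hβ h ((Γ.compatibleEquiv β) J).2
      (Γ.colorBasis n α hf.lift)
    have h2 : ((Γ.compatibleEquiv β) J).2.lift = J := (Γ.compatibleEquiv β).symm_apply_apply J
    rw [coordinate_of_compatible ((Γ.compatibleEquiv β) J).2, h2, coordinate_colorBasis] at h1
    rw [h1]
    change (starRingEnd ℂ) (_ * if J ∘ Γ.circleOf β = f then 1 else 0) = _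
    split_ifs with hJ
    · rw [mul_one, ← hJ]
      rfl
    · rw [mul_zero, map_zero]
  rw [coordinate_of_compatible hf, adjoint, ← LinearMap.toMatrix_mulVec_repr
    (Γ.colorBasis n β) (Γ.colorBasis n α), LinearMap.toMatrix_toLin]
  simp only [Matrix.mulVec, dotProduct, Matrix.conjTranspose_apply, LinearMap.toMatrix_apply]
  change ∑ J, (starRingEnd ℂ) _ * _ = _
  simp_rw [hM]
  by_cases hfβ : Γ.Compatible β f
  · rw [Finset.sum_eq_single hfβ.lift, if_pos, coordinate_of_compatible hfβ]
    · rfl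
    · intro J _ hJ
      rw [if_neg, zero_mul]
      rintro rfl
      exact hJ ((Γ.compatibleEquiv β).symm_apply_apply J).symm
    · simp
  · rw [coordinate_of_not_compatible hfβ, mul_zero]
    refine Finset.sum_eq_zero fun J _ => ?_
    rw [if_neg, zero_mul]
    rintro rfl
    exact hfβ ((compatible_circleOf β).comp J)

variable [LinearOrder E]

/-- Harmonic vectors are the linear combinations of colorings without monochromatic edges. -/
theorem mem_harmonic_iff {v : Γ.StateSpace n α} :
    v ∈ Γ.harmonic n α ↔ ∀ f e, Γ.Mono f e → Γ.coordinate n α f v = 0 := by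
  rw [harmonic, Submodule.mem_inf, LinearMap.mem_ker, LinearMap.mem_ker]
  constructor
  · rintro ⟨hout, hin⟩ f e he
    by_cases hf : Γ.Compatible α f
    · have hu : ∀ b, Γ.Compatible (Function.update α e b) f := fun b => hf.of_mono fun e' he' => by
        by_cases hh : e' = e
        · rwa [hh]
        · simp [hh] at he'
      cases hα : α e with
      | false =>
        have h1 : Γ.edgeMap n α (Function.update α e true) e v = 0 := congrFun hout ⟨e, hα⟩
        have h2 := coordinate_edgeMap hα (by simp) (fun e' he' => by simp [he']) (hu true) v
        rw [h1, map_zero, eq_comm, mul_eq_zero] at h2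
        exact h2.resolve_left (div_ne_zero (gauge_ne_zero f) (gauge_ne_zero f))
      | true =>
        have h1 : Γ.adjoint n (Γ.edgeMap n (Function.update α e false) α e) v = 0 := by
          have h3 : Γ.incomingAdjoint n α v ⟨e, hα⟩ = 0 := by rw [hin, Pi.zero_apply]
          rw [incomingAdjoint, LinearMap.pi_apply] at h3
          dsimp only at h3
          exact h3
        have h2 := coordinate_adjoint_edgeMap (Function.update_self e false α) hα
          (fun e' he' => by simp [he']) (hu false) v
        rw [h1, map_zero, eq_comm, mul_eq_zero] at h2
        exact h2.resolve_left ((map_ne_zero _).mpr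
          (div_ne_zero (gauge_ne_zero f) (gauge_ne_zero f)))
    · exact coordinate_of_not_compatible hf v
  · intro h
    -- Edge maps and their adjoints only transport colorings compatible with both states, and those
    -- are monochromatic at `e`.
    have key : ∀ (e : E) (β : E → Bool) f, Γ.Compatible β f → α e ≠ β e →
        Γ.coordinate n α f v = 0 := by
      intro e β f hβ hne
      by_cases hf : Γ.Compatible α f
      · exact h f e (hf.mono hβ hne)
      · exact coordinate_of_not_compatible hf v
    constructor
    · funext ⟨e, he⟩
      refine stateSpace_ext fun f hf => ?_
      change Γ.coordinate n _ f (Γ.edgeMap n α (Function.update α e true) e v) = _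
      rw [coordinate_edgeMap he (by simp) (fun e' he' => by simp [he']) hf,
        key e _ f hf (by simp [he]), mul_zero]
      exact (map_zero _).symm
    · funext ⟨e, he⟩
      refine stateSpace_ext fun f hf => ?_
      rw [incomingAdjoint, LinearMap.pi_apply, Pi.zero_apply, map_zero,
        coordinate_adjoint_edgeMap (Function.update_self e false α) he (fun e' he' => by simp [he']) hf,
        key e _ f hf (by simp [he]), mul_zero]

theorem finrank_harmonic (α : E → Bool) : Module.finrank ℂ (Γ.harmonic n α) =
    Nat.card {f : Γ.Arc → Fin n // Γ.Compatible α f ∧ ∀ e, ¬ Γ.Mono f e} := by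
  have := Fintype.ofFinite {f : Γ.Arc → Fin n // Γ.Compatible α f ∧ ∀ e, ¬ Γ.Mono f e}
  let φ : Γ.harmonic n α →ₗ[ℂ]
      ({f : Γ.Arc → Fin n // Γ.Compatible α f ∧ ∀ e, ¬ Γ.Mono f e} → ℂ) :=
    (LinearMap.pi fun f => Γ.coordinate n α f.1) ∘ₗ (Γ.harmonic n α).subtype
  have hφ : Function.Bijective φ := by
    constructor
    · intro v w hvw
      refine Subtype.ext (stateSpace_ext fun f hf => ?_)
      by_cases hm : ∃ e, Γ.Mono f e
      · obtain ⟨e, he⟩ := hm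
        rw [mem_harmonic_iff.mp v.2 f e he, mem_harmonic_iff.mp w.2 f e he]
      · exact congrFun hvw ⟨f, hf, not_exists.mp hm⟩
    · intro t
      classical
      obtain ⟨u, hu⟩ := exists_coordinate_eq (Γ := Γ) (α := α) (fun f =>
        if h : Γ.Compatible α f ∧ ∀ e, ¬ Γ.Mono f e then t ⟨f, h⟩ else 0)
        fun f hf => dif_neg fun h => hf h.1
      refine ⟨⟨u, mem_harmonic_iff.mpr fun f e he => ?_⟩, ?_⟩
      · rw [hu, dif_neg]
        exact fun h => h.2 e he
      · funext f
        exact (hu f.1).trans (dif_pos f.2)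
  rw [(LinearEquiv.ofBijective φ hφ).finrank_eq, Module.finrank_fintype_fun_eq_card,
    Nat.card_eq_fintype_card]

/-- Homology is the direct sum of the spaces of harmonic colorings. -/
theorem nonempty_filteredHomology_equiv (i : ℕ) : Nonempty (Γ.FilteredHomology n i ≃ₗ[ℂ]
    ⨁ α : {α : E → Bool // weight α = i}, Γ.harmonic n α.1) := by
  let ι : (∀ α : {α : E → Bool // weight α = i}, Γ.harmonic n α.1) →ₗ[ℂ] Γ.Chain n i :=
    LinearMap.pi fun α => (Γ.harmonic n α.1).subtype ∘ₗ LinearMap.proj α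
  have hι : ∀ z f α e, Γ.Mono f e → Γ.chainCoordinate n i f α (ι z) = 0 := by
    intro z f α e he
    by_cases hα : weight α = i
    · rw [chainCoordinate_of_weight f hα, normCoordinate_eq_zero_iff]
      exact mem_harmonic_iff.mp (z ⟨α, hα⟩).2 f e he
    · exact chainCoordinate_of_weight_ne f hα _
  have hker : ∀ z, ι z ∈ LinearMap.ker (Γ.differential n i) := by
    intro z
    rw [LinearMap.mem_ker]
    refine chain_ext fun f β _ hβ => ?_
    rw [chainCoordinate_differential hβ, map_zero]
    refine Finset.sum_eq_zero fun e _ => ?_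
    split_ifs with he
    · refine mul_eq_zero_of_right _ ?_
      by_cases h : Γ.Compatible (Function.update β e false) f
      · exact hι z f _ e (hβ.mono h (by simp [he]))
      · exact chainCoordinate_of_not_compatible h _
    · rfl
  let ψ := (Submodule.mkQ ((Γ.boundaries n i).comap
    (LinearMap.ker (Γ.differential n i)).subtype)) ∘ₗ ι.codRestrict _ hker
  have hψ : Function.Bijective ψ := by
    constructor
    · rw [← LinearMap.ker_eq_bot, LinearMap.ker_eq_bot']
      intro z hz
      -- Harmonic chains vanish at colorings with a monochromatic edge and boundaries at all others,
      -- so the two meet only in `0`.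
      have hz' : ι z ∈ Γ.boundaries n i := by
        rw [LinearMap.comp_apply, Submodule.mkQ_apply, Submodule.Quotient.mk_eq_zero] at hz
        exact hz
      have h0 : ι z = 0 := chain_ext fun f α _ _ => by
        rw [map_zero]
        by_cases hm : ∃ e, Γ.Mono f e
        · obtain ⟨e, he⟩ := hm
          exact hι z f α e he
        · exact chainCoordinate_eq_zero_of_mem_boundaries hz' (not_exists.mp hm) α
      funext α
      exact Subtype.ext (congrFun h0 α)
    · intro q
      obtain ⟨⟨z, hz⟩, rfl⟩ := Submodule.mkQ_surjective _ q
      classical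
      -- The harmonic representative erases the coordinates of `z` at colorings with a monochromatic
      -- edge; the difference is a boundary by `mem_boundaries`.
      obtain ⟨w, hw⟩ := exists_chainCoordinate_eq (Γ := Γ) (n := n) (i := i)
        (fun f α => if ∃ e, Γ.Mono f e then 0 else Γ.chainCoordinate n i f α z) (by
          intro f α h
          have h1 : Γ.chainCoordinate n i f α z ≠ 0 := by
            intro h1
            simp [h1] at h
          refine ⟨?_, ?_⟩
          · by_contra h2
            exact h1 (chainCoordinate_of_weight_ne f h2 z)
          · by_contra h2
            exact h1 (chainCoordinate_of_not_compatible h2 z))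
      have hwh : ∀ α : {α : E → Bool // weight α = i}, w α ∈ Γ.harmonic n α.1 := by
        intro α
        rw [mem_harmonic_iff]
        intro f e he
        rw [← normCoordinate_eq_zero_iff, ← chainCoordinate_of_weight f α.2, hw, if_pos ⟨e, he⟩]
      refine ⟨fun α => ⟨w α, hwh α⟩, ?_⟩
      rw [LinearMap.comp_apply, ← sub_eq_zero, ← map_sub, Submodule.mkQ_apply,
        Submodule.Quotient.mk_eq_zero, Submodule.mem_comap]
      have hιw : ι (fun α => ⟨w α, hwh α⟩) = w := rfl
      refine mem_boundaries (LinearMap.mem_ker.mp (SetLike.coe_mem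
        ((LinearMap.codRestrict (Γ.differential n i).ker ι hker) _ - ⟨z, hz⟩))) fun f hf α => ?_
      change Γ.chainCoordinate n i f α (w - z) = 0
      rw [map_sub, hw, if_neg (not_exists.mpr hf), sub_self]
  exact ⟨(LinearEquiv.ofBijective ψ hψ).symm.trans
    (DirectSum.linearEquivFunOnFintype ℂ _ _).symm⟩

theorem finrank_filteredHomology_zero :
    Module.finrank ℂ (Γ.FilteredHomology n 0) =
      Module.finrank ℂ (Γ.harmonic n fun _ => false) := by
  obtain ⟨φ⟩ := nonempty_filteredHomology_equiv (Γ := Γ) (n := n) 0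
  have h0 : weight (fun _ : E => false) = 0 := by simp [weight]
  let : Unique {α : E → Bool // weight α = 0} :=
    { default := ⟨fun _ => false, h0⟩
      uniq := by
        rintro ⟨α, hα⟩
        refine Subtype.ext (funext fun e => ?_)
        rw [weight, Finset.card_eq_zero, Finset.filter_eq_empty_iff] at hα
        simpa using hα (Finset.mem_univ e) }
  rw [(φ.trans (DirectSum.linearEquivFunOnFintype ℂ _ _)).finrank_eq,
    (LinearEquiv.piUnique ℂ _).finrank_eq,
    show (default : {α : E → Bool // weight α = 0}).1 = fun _ => false from rfl]

end Harmonic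

/-! ### Faces of the state graphs -/

section Faces

variable {V E : Type*} {Γ : RibbonGraph V E}

/-- The arc of the blowup that runs along a piece of the boundary of the ribbon surface. -/
def pieceArc (Γ : RibbonGraph V E) : Γ.BoundaryPiece → Γ.Arc
  | Sum.inl (h, s) => Γ.cornerArc h s
  | Sum.inr v => Sum.inr v

/-- A piece of the boundary of the ribbon surface along a given arc. -/
def arcPiece (Γ : RibbonGraph V E) : Γ.Arc → Γ.BoundaryPiece
  | Sum.inl h => Sum.inl (h, true)
  | Sum.inr v => Sum.inr v

/-- The face of a ribbon graph along an arc of the blowup. -/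
def arcFace (Γ : RibbonGraph V E) (a : Γ.Arc) : Γ.Face :=
  Quotient.mk (Relation.EqvGen.setoid Γ.BoundarySegment) (Γ.arcPiece a)

theorem faceAt_eq_arcFace (h : E × Bool) (s : Bool) :
    Γ.faceAt h s = Γ.arcFace (Γ.cornerArc h s) := by
  cases s
  · have h1 := BoundarySegment.disc (Γ := Γ) (Γ.rot.symm h)
    rw [Equiv.apply_symm_apply] at h1
    exact (Quotient.sound (s := Relation.EqvGen.setoid Γ.BoundarySegment) (.rel _ _ h1)).symm
  · rfl

theorem mk_eq_arcFace (p : Γ.BoundaryPiece) :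
    Quotient.mk (Relation.EqvGen.setoid Γ.BoundarySegment) p = Γ.arcFace (Γ.pieceArc p) := by
  rcases p with ⟨h, s⟩ | v
  · exact faceAt_eq_arcFace h s
  · rfl

theorem faceAt_oppHalf (h : E × Bool) (s : Bool) :
    Γ.faceAt h s = Γ.faceAt (oppHalf h) (xor s (!(Γ.neg h.1))) := by
  refine Quotient.sound (s := Relation.EqvGen.setoid Γ.BoundarySegment) (.rel _ _ ?_)
  cases hn : Γ.neg h.1
  · simpa using BoundarySegment.flatBand h s hn
  · simpa using BoundarySegment.twistedBand h s hn

/-- The faces of the state graph of `α` are the circles of the state `α`. -/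
def faceFunctionEquiv {X : Type*} (Γ : RibbonGraph V E) (α : E → Bool) :
    ((Γ.stateGraph α).Face → X) ≃ {f : Γ.Arc → X // Γ.Compatible α f} where
  -- A band of the state graph is twisted exactly when the strands of `α` at that edge cross, so the
  -- two gluing rules coincide.
  toFun F := ⟨fun a => F ((Γ.stateGraph α).arcFace a), compatible_iff.mpr fun h s => by
    have h1 := faceAt_oppHalf (Γ := Γ.stateGraph α) h s
    rw [faceAt_eq_arcFace, faceAt_eq_arcFace] at h1
    refine (congrArg F h1).trans ?_
    rw [Bool.xor_comm (α h.1)]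
    rfl⟩
  invFun f := Quotient.lift (s := Relation.EqvGen.setoid (Γ.stateGraph α).BoundarySegment)
    (fun p => f.1 (Γ.pieceArc p)) (by
      intro p q h
      induction h with
      | rel p q h =>
        rcases h with h | ⟨h, s, hf⟩ | ⟨h, s, ht⟩
        · change f.1 (Γ.cornerArc h true) = f.1 (Γ.cornerArc (Γ.rot h) false)
          simp [cornerArc, arcAfter, arcBefore]
        · have h1 := compatible_iff.mp f.2 h s
          have h2 : xor (α h.1) (Γ.neg h.1) = false := by
            rw [Bool.xor_comm]
            exact hf
          rw [h2] at h1
          rcases s <;> exact h1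
        · have h1 := compatible_iff.mp f.2 h s
          have h2 : xor (α h.1) (Γ.neg h.1) = true := by
            rw [Bool.xor_comm]
            exact ht
          rw [h2] at h1
          rcases s <;> exact h1
      | refl => rfl
      | symm _ _ _ ih => exact ih.symm
      | trans _ _ _ _ _ ih₁ ih₂ => exact ih₁.trans ih₂)
  left_inv F := by
    funext x
    induction x using Quotient.inductionOn with
    | _ p =>
      rcases p with ⟨h, s | s⟩ | v
      · exact congrArg F (mk_eq_arcFace (Γ := Γ.stateGraph α) (Sum.inl (h, false))).symm
      · rfl
      · rfl
  right_inv f := by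
    refine Subtype.ext (funext fun a => ?_)
    cases a <;> rfl

theorem card_faceColoring (n : ℕ) (α : E → Bool) :
    Nat.card ((Γ.stateGraph α).FaceColoring n) =
      Nat.card {f : Γ.Arc → Fin n // Γ.Compatible α f ∧ ∀ e, ¬ Γ.Mono f e} := by
  refine Nat.card_congr (((Γ.faceFunctionEquiv α).subtypeEquiv (q := fun f => ∀ e, ¬ Γ.Mono f.1 e)
    fun F => forall_congr' fun e => ?_).trans
    (Equiv.subtypeSubtypeEquivSubtypeInter _ fun f => ∀ e, ¬ Γ.Mono f e))
  rw [faceAt_eq_arcFace, faceAt_eq_arcFace]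
  rfl

theorem stateGraph_false : (Γ.stateGraph fun _ => false) = Γ := by
  cases Γ
  simp [stateGraph]

/-- Every ribbon graph is equivalent to itself. -/
def Equivalence.refl (Γ : RibbonGraph V E) : Γ.Equivalence Γ where
  onVert := Equiv.refl _
  onHalf := Equiv.refl _
  flip _ := false
  map_opp _ := rfl
  map_vert _ := rfl
  map_rot _ := rfl
  map_neg _ := by simp

end Faces

end RibbonGraph

namespace RibbonGraph

/-! ### Parity of the states of plane ribbon graphs -/

section Plane

/-- The kernel lies in the line of constants. Applied to functions on vertices and on faces, this
turns connectedness of the graph and of its dual into lower bounds for ranks. -/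
theorem card_le_finrank_range_add_one {K X W : Type*} [Field K] [Fintype X] [AddCommGroup W]
    [Module K W] (T : (X → K) →ₗ[K] W) (hT : ∀ φ, T φ = 0 → ∀ x y, φ x = φ y) :
    Fintype.card X ≤ Module.finrank K (LinearMap.range T) + 1 := by
  have h1 : LinearMap.ker T ≤ Submodule.span K {fun _ => 1} := by
    intro φ hφ
    rw [Submodule.mem_span_singleton]
    rcases isEmpty_or_nonempty X with _ | ⟨⟨x⟩⟩
    · exact ⟨0, Subsingleton.elim _ _⟩
    · exact ⟨φ x, funext fun y => by simpa using hT φ hφ x y⟩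
  have h2 : Module.finrank K (LinearMap.ker T) ≤ 1 :=
    (Submodule.finrank_mono h1).trans 
      (by simpa using finrank_span_le_card (R := K) {fun _ : X => (1 : K)})
  have h3 := LinearMap.finrank_range_add_finrank_ker T
  rw [Module.finrank_fintype_fun_eq_card] at h3
  omega

variable {V E : Type*} {Γ : RibbonGraph V E}

theorem Connected.eq_of_vert_eq {X : Type*} (hΓ : Γ.Connected) (g : E × Bool → X)
    (hrot : ∀ h, g (Γ.rot h) = g h) (hopp : ∀ h, g (oppHalf h) = g h) (h h' : E × Bool) :
    g h = g h' := by
  have hcyc : ∀ h h', Γ.vert h = Γ.vert h' → g h = g h' := by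
    intro h h' hv
    obtain ⟨i, rfl⟩ := (Γ.sameCycle_iff h h').mpr hv
    clear hv
    induction i using Int.induction_on with
    | zero => rfl
    | succ i ih => rw [add_comm, zpow_add, Equiv.Perm.mul_apply, zpow_one, hrot, ih]
    | pred i ih =>
      rw [ih, ← hrot ((Γ.rot ^ (-(i : ℤ) - 1)) h), ← Equiv.Perm.mul_apply, ← zpow_one_add]
      congr 3
      ring
  have key : ∀ v, Relation.ReflTransGen Γ.graph.Adj (Γ.vert h) v → ∀ h', Γ.vert h' = v →
      g h = g h' := by
    intro v hv
    induction hv with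
    | refl => exact fun h' hh => hcyc _ _ hh.symm
    | tail _ hadj ih =>
      rintro h' rfl
      obtain ⟨e, ⟨h1, h2⟩ | ⟨h1, h2⟩⟩ := hadj
      · exact (ih _ h1).trans ((hopp (e, false)).symm.trans (hcyc _ _ h2))
      · exact (ih _ h2).trans ((hopp (e, true)).symm.trans (hcyc _ _ h1))
  exact key _ (hΓ.2 _ _) h' rfl

theorem Connected.isEmpty_isolated [Nonempty E] (hΓ : Γ.Connected) : IsEmpty Γ.Isolated := by
  refine ⟨fun v => ?_⟩
  obtain ⟨e⟩ := ‹Nonempty E›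
  rcases (hΓ.2 v.1 (Γ.vert (e, false))).cases_head with h | ⟨w, ⟨e', ⟨h1, _⟩ | ⟨_, h1⟩⟩, _⟩
  · exact v.2 _ h.symm
  · exact v.2 _ h1
  · exact v.2 _ h1

/-- This is connectedness of the dual graph: `φ` becomes a function of half-edges invariant under
`rot` and `oppHalf`. An edge is needed so that every face runs along some half-edge. -/
theorem Connected.faceFunction_const [Nonempty E] {X : Type*} (hΓ : Γ.Connected) (φ : Γ.Face → X)
    (hφ : ∀ e : E, φ (Γ.faceAt (e, false) true) = φ (Γ.faceAt (e, false) false)) (x y : Γ.Face) :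
    φ x = φ y := by
  have h1 : ∀ h, φ (Γ.faceAt h true) = φ (Γ.faceAt h false) := by
    rintro ⟨e, _ | _⟩
    · exact hφ e
    · rw [faceAt_oppHalf (e, true) true, faceAt_oppHalf (e, true) false]
      cases Γ.neg e
      · exact (hφ e).symm
      · exact hφ e
  have h2 : ∀ h, φ (Γ.faceAt (oppHalf h) true) = φ (Γ.faceAt h true) := by
    intro h
    rw [faceAt_oppHalf h true]
    cases Γ.neg h.1
    · exact h1 _
    · rfl
  have h3 : ∀ h, φ (Γ.faceAt (Γ.rot h) true) = φ (Γ.faceAt h true) := by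
    intro h
    rw [h1, faceAt_eq_arcFace, faceAt_eq_arcFace]
    simp [cornerArc, arcBefore, arcAfter]
  have h4 := hΓ.eq_of_vert_eq (fun h => φ (Γ.faceAt h true)) h3 h2
  have hI := hΓ.isEmpty_isolated
  have h5 : ∀ x : Γ.Face, ∃ h, φ x = φ (Γ.faceAt h true) := by
    intro x
    induction x using Quotient.inductionOn with
    | _ p =>
      rcases p with ⟨h, _ | _⟩ | v
      · exact ⟨h, (h1 h).symm⟩
      · exact ⟨h, rfl⟩
      · exact hI.elim v
  obtain ⟨h, hx⟩ := h5 x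
  obtain ⟨h', hy⟩ := h5 y
  rw [hx, hy]
  exact h4 h h'

/-- In a connected plane ribbon graph, every cycle modulo `2` is a boundary. -/
theorem exists_faceFunction [Finite V] [Fintype E] [DecidableEq V] (hΓ : Γ.Connected)
    (hp : Γ.IsPlane) (s : E → ZMod 2)
    (hs : ∀ v, ∑ h : E × Bool, (if Γ.vert h = v then s h.1 else 0) = 0) :
    ∃ φ : Γ.Face → ZMod 2, ∀ e, φ (Γ.faceAt (e, false) true) + φ (Γ.faceAt (e, false) false) =
      s e := by
  classical
  rcases isEmpty_or_nonempty E with _ | _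
  · exact ⟨0, fun e => isEmptyElim e⟩
  have := Fintype.ofFinite V
  have := Fintype.ofFinite Γ.Face
  let A : Matrix V E (ZMod 2) := fun v e => ∑ b : Bool, if Γ.vert (e, b) = v then 1 else 0
  let B : (Γ.Face → ZMod 2) →ₗ[ZMod 2] (E → ZMod 2) := LinearMap.pi fun e =>
    LinearMap.proj (R := ZMod 2) (φ := fun _ => ZMod 2) (Γ.faceAt (e, false) true) +
      LinearMap.proj (Γ.faceAt (e, false) false)
  have hA : ∀ t v, A.mulVecLin t v = ∑ h : E × Bool, (if Γ.vert h = v then t h.1 else 0) := by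
    intro t v
    rw [Matrix.mulVecLin_apply, Matrix.mulVec, dotProduct, Fintype.sum_prod_type]
    refine Finset.sum_congr rfl fun e _ => ?_
    rw [Finset.sum_mul]
    simp only [ite_mul, one_mul, zero_mul]
  have hAt : ∀ ψ e, A.transpose.mulVecLin ψ e = ψ (Γ.vert (e, true)) + ψ (Γ.vert (e, false)) := by
    intro ψ e
    rw [Matrix.mulVecLin_apply, Matrix.mulVec, dotProduct]
    change ∑ v, (∑ b : Bool, if Γ.vert (e, b) = v then (1 : ZMod 2) else 0) * ψ v = _
    simp only [Fintype.sum_bool, add_mul, ite_mul, one_mul, zero_mul,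
      Finset.sum_add_distrib, Finset.sum_ite_eq, Finset.mem_univ, if_true]
  have hrankA : Fintype.card V ≤ A.rank + 1 := by
    rw [← Matrix.rank_transpose]
    refine card_le_finrank_range_add_one _ fun ψ hψ u v => ?_
    have key : ∀ v, Relation.ReflTransGen Γ.graph.Adj u v → ψ u = ψ v := by
      intro v hv
      induction hv with
      | refl => rfl
      | tail _ hadj ih =>
        obtain ⟨e, hadj⟩ := hadj
        have h1 := hAt ψ e
        rw [hψ, Pi.zero_apply, eq_comm, CharTwo.add_eq_zero] at h1
        rcases hadj with ⟨h2, h3⟩ | ⟨h2, h3⟩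
        · rw [ih, ← h2, ← h3, h1]
        · rw [ih, ← h2, ← h3, h1]
    exact key v (hΓ.2 u v)
  have hrankB : Fintype.card Γ.Face ≤ Module.finrank (ZMod 2) (LinearMap.range B) + 1 :=
    card_le_finrank_range_add_one _ fun φ hφ x y =>
      hΓ.faceFunction_const φ (fun e => CharTwo.add_eq_zero.mp (congrFun hφ e)) x y
  -- Boundaries are cycles: around a vertex each corner arc is counted from both of its ends.
  have hle : LinearMap.range B ≤ LinearMap.ker A.mulVecLin := by
    rintro _ ⟨φ, rfl⟩
    rw [LinearMap.mem_ker]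
    funext v
    rw [hA, Pi.zero_apply]
    refine Eq.trans ?_ (sum_arcBefore_add_arcAfter v fun a => φ (Γ.arcFace a))
    refine Finset.sum_congr rfl fun h _ => ?_
    congr 1
    change _ = φ (Γ.arcFace (Γ.cornerArc h true)) + φ (Γ.arcFace (Γ.cornerArc h false))
    rw [← faceAt_eq_arcFace, ← faceAt_eq_arcFace]
    rcases h with ⟨e, _ | _⟩
    · rfl
    · rw [faceAt_oppHalf (e, true) true, faceAt_oppHalf (e, true) false]
      cases Γ.neg e
      · exact add_comm _ _
      · rfl
  have hker := LinearMap.finrank_range_add_finrank_ker A.mulVecLin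
  rw [Module.finrank_fintype_fun_eq_card] at hker
  rw [IsPlane, Nat.card_eq_fintype_card, Nat.card_eq_fintype_card, Nat.card_eq_fintype_card] at hp
  -- The cycle space has dimension at most `|E| - |V| + 1`, which Euler's formula equates with `|F|
  -- - 1`, a lower bound for the dimension of the boundaries.
  have heq := Submodule.eq_of_le_of_finrank_le hle (by rw [Matrix.rank] at hrankA; omega)
  have hmem : s ∈ LinearMap.range B := by
    rw [heq, LinearMap.mem_ker]
    funext v
    rw [hA, hs, Pi.zero_apply]
  obtain ⟨φ, hφ⟩ := hmem
  exact ⟨φ, fun e => congrFun hφ e⟩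

/-- A state of a plane ribbon graph that has a coloring without monochromatic edges has an even
number of `1`-smoothings. -/
theorem even_weight_of_isPlane [Finite V] [Fintype E] {X : Type*} [LinearOrder X] [Fintype X]
    (hΓ : Γ.Connected) (hp : Γ.IsPlane) {α : E → Bool} {f : Γ.Arc → X} (hf : Γ.Compatible α f)
    (hm : ∀ e, ¬ Γ.Mono f e) : Even (weight α) := by
  classical
  -- This counts modulo `2` the strands of color `a` at `e`. It is a cycle, and `φ a` bounds it.
  let s : X → E → ZMod 2 := fun a e => (if f (Γ.arcAfter (e, false)) = a then 1 else 0) +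
    if f (Γ.arcBefore (e, false)) = a then 1 else 0
  have hs : ∀ a (h : E × Bool), s a h.1 = (if f (Γ.arcAfter h) = a then 1 else 0) +
      if f (Γ.arcBefore h) = a then 1 else 0 := by
    rintro a ⟨e, _ | _⟩
    · rfl
    · have h1 := compatible_iff.mp hf (e, true) true
      have h2 := compatible_iff.mp hf (e, true) false
      simp only [cornerArc, oppHalf] at h1 h2
      rw [h1, h2]
      cases xor (α e) (Γ.neg e)
      · exact add_comm _ _
      · rfl
  choose φ hφ using fun a => exists_faceFunction hΓ hp (s a) fun v => by
    simp_rw [hs]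
    exact sum_arcBefore_add_arcAfter v fun x => if f x = a then 1 else 0
  -- The faces here are those of `Γ`, not of the state graph. Along a strand `W` can change only
  -- where the strand crosses to the other side of a band, and it then jumps by the number of
  -- strands of smaller color at that edge.
  let W : Γ.Arc → ZMod 2 := fun x => ∑ a with a < f x, φ a (Γ.arcFace x)
  have hstrand : ∀ e t, W (Γ.cornerArc (e, false) t) +
      W (Γ.cornerArc (e, true) (xor t (!(xor (α e) (Γ.neg e))))) =
      if α e = true then
        (if f (Γ.arcAfter (e, false)) < f (Γ.cornerArc (e, false) t) then 1 else 0) +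
        (if f (Γ.arcBefore (e, false)) < f (Γ.cornerArc (e, false) t) then 1 else 0) else 0 := by
    intro e t
    have h1 : f (Γ.cornerArc (e, true) (xor t (!(xor (α e) (Γ.neg e))))) =
        f (Γ.cornerArc (e, false) t) := (compatible_iff.mp hf (e, false) t).symm
    have h2 : Γ.arcFace (Γ.cornerArc (e, true) (xor t (!(xor (α e) (Γ.neg e))))) =
        Γ.faceAt (e, false) (xor t (α e)) := by
      rw [← faceAt_eq_arcFace, faceAt_oppHalf]
      cases t <;> cases α e <;> cases Γ.neg e <;> rfl
    have h3 : ∀ a, φ a (Γ.faceAt (e, false) t) + φ a (Γ.faceAt (e, false) (xor t (α e))) =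
        if α e = true then s a e else 0 := by
      intro a
      rw [← hφ]
      cases t <;> cases α e
      · exact CharTwo.add_self_eq_zero _
      · exact add_comm _ _
      · exact CharTwo.add_self_eq_zero _
      · rfl
    simp only [W, h1, h2]
    rw [← faceAt_eq_arcFace, ← Finset.sum_add_distrib]
    simp_rw [h3]
    by_cases hα : α e = true
    · simp only [hα, if_true, s]
      rw [Finset.sum_add_distrib]
      simp
    · simp [hα]
  have hedge : ∀ e, W (Γ.arcAfter (e, true)) + W (Γ.arcBefore (e, true)) +
      (W (Γ.arcAfter (e, false)) + W (Γ.arcBefore (e, false))) = if α e = true then 1 else 0 := by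
    intro e
    have h1 := hstrand e true
    have h2 := hstrand e false
    have h3 : W (Γ.arcAfter (e, true)) + W (Γ.arcBefore (e, true)) +
      (W (Γ.arcAfter (e, false)) + W (Γ.arcBefore (e, false))) =
      (W (Γ.cornerArc (e, false) true) +
        W (Γ.cornerArc (e, true) (xor true (!(xor (α e) (Γ.neg e)))))) +
      (W (Γ.cornerArc (e, false) false) +
        W (Γ.cornerArc (e, true) (xor false (!(xor (α e) (Γ.neg e)))))) := by
      cases xor (α e) (Γ.neg e) <;> simp only [cornerArc, Bool.xor_false, Bool.xor_true,
        Bool.not_false, Bool.not_true] <;> ring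
    rw [h3, h1, h2]
    by_cases hα : α e = true
    · simp only [hα, if_true, cornerArc, lt_irrefl, if_false, zero_add, add_zero]
      -- Of two crossing strands with different colors, exactly one meets a smaller color, so every
      -- crossing counts once.
      rcases lt_or_gt_of_ne (hm e) with h | h
      · simp [h, h.not_gt]
      · simp [h, h.not_gt]
    · simp [hα]
  have hsum := sum_cornerArc W
  rw [Fintype.sum_prod_type] at hsum
  simp only [Fintype.sum_bool, hedge] at hsum
  rw [Finset.sum_boole, ZMod.natCast_eq_zero_iff_even] at hsum
  exact hsum

end Plane

end RibbonGraph

/-! ### Assembly of the theorem -/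

theorem theoremD {V E : Type*} [Finite V] [Fintype E] [LinearOrder E] (Γ : RibbonGraph V E)
    (hΓ : Γ.Connected) (n : ℕ) [NeZero n] :
    -- the filtered complex is a complex
    (∀ i, Γ.differential n (i + 1) ∘ₗ Γ.differential n i = 0) ∧
    -- homology is the direct sum of the spaces of harmonic colorings of the states
    (∀ i, Nonempty (Γ.FilteredHomology n i ≃ₗ[ℂ]
      ⨁ α : {α : E → Bool // RibbonGraph.weight α = i}, Γ.harmonic n α.1)) ∧
    (Γ.IsPlane → ∀ α : E → Bool, Γ.harmonic n α ≠ ⊥ → Even (RibbonGraph.weight α)) ∧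
    -- harmonic colorings count face colorings of the state graph
    (∀ α : E → Bool, Module.finrank ℂ (Γ.harmonic n α) =
      Nat.card ((Γ.stateGraph α).FaceColoring n)) ∧
    -- the all-zero state
    Nonempty ((Γ.stateGraph fun _ => false).Equivalence Γ) ∧
    Module.finrank ℂ (Γ.FilteredHomology n 0) = Module.finrank ℂ (Γ.harmonic n fun _ => false) ∧
    Module.finrank ℂ (Γ.harmonic n fun _ => false) = Nat.card (Γ.FaceColoring n) ∧
    (Γ.IsPlane → Module.finrank ℂ (Γ.FilteredHomology 4 0) = Nat.card (Γ.FaceColoring 4)) := by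
  classical
  refine ⟨fun i => RibbonGraph.differential_comp_differential i,
    fun i => RibbonGraph.nonempty_filteredHomology_equiv i, fun hp α hα => ?_, fun α => ?_, ?_,
    RibbonGraph.finrank_filteredHomology_zero, ?_, fun _ => ?_⟩
  · obtain ⟨v, hv, hv0⟩ := Submodule.exists_mem_ne_zero_of_ne_bot hα
    by_contra hodd
    refine hv0 (RibbonGraph.stateSpace_ext fun f hf => ?_)
    rw [map_zero]
    by_cases hm : ∃ e, Γ.Mono f e
    · obtain ⟨e, he⟩ := hm
      exact RibbonGraph.mem_harmonic_iff.mp hv f e he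
    · exact absurd (RibbonGraph.even_weight_of_isPlane hΓ hp hf (not_exists.mp hm)) hodd
  · rw [RibbonGraph.finrank_harmonic, RibbonGraph.card_faceColoring]
  · rw [RibbonGraph.stateGraph_false]
    exact ⟨RibbonGraph.Equivalence.refl Γ⟩
  · rw [RibbonGraph.finrank_harmonic, ← RibbonGraph.card_faceColoring, RibbonGraph.stateGraph_false]
  · rw [RibbonGraph.finrank_filteredHomology_zero, RibbonGraph.finrank_harmonic,
      ← RibbonGraph.card_faceColoring, RibbonGraph.stateGraph_false]
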